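/- An ideal on $\mathbb N$ is a nonempty family of subsets of $\mathbb N$ closed under subsets and finite unions. Subsets of $\mathbb N$ are identified with points of the Cantor space $2^{\mathbb N}$, which gives the notions of a Borel ideal and of a Borel map $\mathcal P(\mathbb N)\to\mathcal P(\mathbb N)$. For ideals $\mathcal I,\mathcal J$ on $\mathbb N$, $\mathcal I$ is Borel reducible to $\mathcal J$, written $\mathcal I\le_B\mathcal J$, if there is a Borel map $\vartheta:\mathcal P(\mathbb N)\to\mathcal P(\mathbb N)$ such that for all $x,y\subseteq\mathbb N$: $x\,\Delta\,y\in\mathcal I$ if and only if $\vartheta(x)\,\Delta\,\vartheta(y)\in\mathcal J$. An ideal $\mathcal J$ is a P-ideal if for every sequence of sets $x_n\in\mathcal J$ there is $x\in\mathcal J$ such that $x_n\setminus x$ is finite for all $n$. Let $\mathcal Z_0=\{x\subseteq\mathbb N:\lim_{n\to\infty}\#(x\cap[0,n))/n=0\}$ be the density ideal. Let $(r_n)_{n\in\mathbb N}$ be real numbers with $r_n\ge 0$, $r_n\to 0$ and $\sum_n r_n=\infty$, and let $\mathcal I_{\{r_n\}}=\{x\subseteq\mathbb N:\sum_{n\in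 x}r_n<\infty\}$ be the corresponding summable ideal. Then: (i) (Farah) If $\mathcal J$ is a Borel P-ideal on $\mathbb N$ and $\mathcal I_{\{r_n\}}\le_B\mathcal J$, then there are pairwise disjoint finite nonempty sets $w_k\subseteq\mathbb N$ with $\max w_k<\min w_{k+1}$ for all $k$, such that for every $x\subseteq\mathbb N$: $x\in\mathcal I_{\{r_n\}}$ if and only if $\bigcup_{k\in x}w_k\in\mathcal J$; and moreover there are natural numbers $k_i$ with $w_i\subseteq[k_i,k_{i+1})$ and $k_{i+1}\ge 2k_i$ for all $i$. (ii) (Hjorth) $\mathcal I_{\{r_n\}}$ is not Borel reducible to $\mathcal Z_0$. -/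

import Mathlib

open Filter Topology

/-! Ideals on `ℕ` are Mathlib's order ideals of the power set `Set ℕ`: nonempty families of subsets
of `ℕ` which are closed under subsets and directed (equivalently, closed under finite unions).

The power set `Set ℕ` carries Mathlib's σ-algebra `Set.instMeasurableSpace`, the product of the
discrete σ-algebras over the countable index set `ℕ`; this is the Borel σ-algebra of the Cantor
space `2^ℕ`. So Borel sets and maps are the measurable ones. -/

/-- Borel reducibility of (equivalence) relations. -/
def BorelReducible {X Y : Type*} [MeasurableSpace X] [MeasurableSpace Y]
    (E : X → X → Prop) (F : Y → Y → Prop) : Prop :=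
  ∃ θ : X → Y, Measurable θ ∧ ∀ x y : X, E x y ↔ F (θ x) (θ y)

/-- The equivalence relation of an ideal: `x` and `y` are equivalent when `x ∆ y` is in the
ideal. -/
def idealRel (I : Order.Ideal (Set ℕ)) (x y : Set ℕ) : Prop :=
  symmDiff x y ∈ I

/-- Borel reducibility of ideals on `ℕ`. -/
def IdealBorelReducible (I J : Order.Ideal (Set ℕ)) : Prop :=
  BorelReducible (idealRel I) (idealRel J)

/-- The ideal is a Borel subset of the power set of `ℕ`. -/
def IsBorelIdeal (I : Order.Ideal (Set ℕ)) : Prop :=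
  MeasurableSet (I : Set (Set ℕ))

/-- P-ideals: every sequence of members is almost contained in a single member. -/
def IsPIdeal (I : Order.Ideal (Set ℕ)) : Prop :=
  ∀ x : ℕ → Set ℕ, (∀ n, x n ∈ I) → ∃ y ∈ I, ∀ n, (x n \ y).Finite

/-- `w` witnesses that `I` is Rudin–Blass reducible to `J` via consecutive sets: the `w k` are
nonempty, finite, pairwise disjoint, `max (w k) < min (w (k + 1))`, and `x` is in `I` exactly when
the union of the `w k`, `k ∈ x`, is in `J`. -/
structure IsRBppReduction (I J : Order.Ideal (Set ℕ)) (w : ℕ → Finset ℕ) : Prop where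
  nonempty : ∀ k, (w k).Nonempty
  disjoint : ∀ k l, k ≠ l → Disjoint (w k) (w l)
  consecutive : ∀ k, (w k).max' (nonempty k) < (w (k + 1)).min' (nonempty (k + 1))
  mem_iff : ∀ x : Set ℕ, x ∈ I ↔ (⋃ k ∈ x, (w k : Set ℕ)) ∈ J

/-- `I` is Rudin–Blass reducible to `J` via consecutive finite sets, exponentially: in addition
the sets `w i` lie in intervals `[k i, k (i + 1))` with `k (i + 1) ≥ 2 * k i`. -/
def RBppExponentially (I J : Order.Ideal (Set ℕ)) : Prop :=
  ∃ w : ℕ → Finset ℕ, IsRBppReduction I J w ∧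
    ∃ k : ℕ → ℕ, (∀ i, w i ⊆ Finset.Ico (k i) (k (i + 1))) ∧ ∀ i, 2 * k i ≤ k (i + 1)

/-- The summable ideal of a sequence of nonnegative reals: all `x ⊆ ℕ` such that the sum of `r n`
over `n ∈ x` is finite. -/
def summableIdeal (r : ℕ → ℝ) (hr : ∀ n, 0 ≤ r n) : Order.Ideal (Set ℕ) where
  carrier := {x | Summable fun n : x => r n}
  lower' := by
    intro x y hyx hx
    have hx' : Summable (x.indicator r) := summable_subtype_iff_indicator.mp hx
    refine summable_subtype_iff_indicator.mpr
      (Summable.of_nonneg_of_le (fun n => Set.indicator_nonneg (fun n _ => hr n) n) ?_ hx')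
    exact fun n => Set.indicator_le_indicator_of_subset hyx hr n
  nonempty' := ⟨∅, summable_of_hasFiniteSupport (Set.toFinite _)⟩
  directed' := by
    intro x hx y hy
    have hx' : Summable (x.indicator r) := summable_subtype_iff_indicator.mp hx
    have hy' : Summable (y.indicator r) := summable_subtype_iff_indicator.mp hy
    refine ⟨x ∪ y, summable_subtype_iff_indicator.mpr (Summable.of_nonneg_of_le
      (fun n => Set.indicator_nonneg (fun n _ => hr n) n) ?_ (hx'.add hy')),
      Set.subset_union_left, Set.subset_union_right⟩
    intro n
    by_cases h1 : n ∈ x <;> by_cases h2 : n ∈ y <;> simp [h1, h2, hr n]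

/-- The density ideal `Z₀`: all `x ⊆ ℕ` with `#(x ∩ [0, n)) / n → 0`. -/
def densityIdeal : Order.Ideal (Set ℕ) where
  carrier := {x | Tendsto (fun n : ℕ => ((x ∩ Set.Iio n).ncard : ℝ) / n) atTop (𝓝 0)}
  lower' := by
    intro x y hyx hx
    refine squeeze_zero (fun n => by positivity) (fun n => ?_) hx
    have : (y ∩ Set.Iio n).ncard ≤ (x ∩ Set.Iio n).ncard :=
      Set.ncard_le_ncard (Set.inter_subset_inter_left _ hyx)
        ((Set.finite_Iio n).subset Set.inter_subset_right)
    gcongr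
  nonempty' := ⟨∅, by simp⟩
  directed' := by
    intro x hx y hy
    refine ⟨x ∪ y, ?_, Set.subset_union_left, Set.subset_union_right⟩
    have hxy := Tendsto.add hx hy
    rw [add_zero] at hxy
    refine squeeze_zero (fun n => by positivity) (fun n => ?_) hxy
    have : ((x ∪ y) ∩ Set.Iio n).ncard ≤ (x ∩ Set.Iio n).ncard + (y ∩ Set.Iio n).ncard := by
      rw [Set.union_inter_distrib_right]
      exact Set.ncard_union_le _ _
    rw [← add_div]
    gcongr
    exact_mod_cast this

/-! A Borel P-ideal J behaves as if it were given by a submeasure. Call a closed hereditary family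
large if it contains a tail of every member of J. `IsPIdeal.exists_exhaustion` produces large
families F i such that unions of two members of F (i + 1) lie in F i, and such that having tails in
all F i implies membership in J (for sets whose points are singletons of J). The F i play the role
of balls of radius 2⁻ⁱ. They come from a continuous parametrization of J by Baire space, through
fusion arguments driven by the P-property.

Given a Borel reduction θ, Baire category yields finite strings, the stabilizers of
`exists_stabilizer`. Once such a string is placed on [b, a), coordinates from b on fix θ below some
k when the coordinates before b are known, while changing the coordinates before b affects θ above k
only by a member of F i. Between the strings, finite blocks are inserted whose r-sums approximate r
i up to a summable error. The effect of the i-th block on θ is then concentrated, up to an error in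
F i, on an interval [k i, k (i + 1)); this trace is w i. Errors in F i on consecutive intervals add
up to a member of J (`mem_of_blocks_mem`), as in a geometric series. Hence x ↦ ⋃ w i, i ∈ x, is a
reduction (`exists_block_reduction`), and the k i can be made to grow as fast as desired.

For Hjorth's theorem, Z₀ is a Borel P-ideal, so an exponential reduction would exist. Either the
relative sizes of the w i tend to 0, and doubling puts the union of all w i into Z₀ although ℕ is
not summable; or infinitely many w i are large, and a sparse infinite set of their indices is
summable while its union is not in Z₀. -/

/-! ### Large families in a P-ideal -/

/-- `A` is cofinal in the ideal `I` with respect to almost inclusion. -/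
def IsAlmostCofinal (I : Order.Ideal (Set ℕ)) (A : Set (Set ℕ)) : Prop :=
  ∀ x ∈ I, ∃ y ∈ A, (x \ y).Finite

/-- The sets all of whose finite subsets `E` leave `{y ∈ A | E ⊆ y}` cofinal in `I`. -/
def cofinalTraces (I : Order.Ideal (Set ℕ)) (A : Set (Set ℕ)) : Set (Set ℕ) :=
  {x | ∀ E : Finset ℕ, (E : Set ℕ) ⊆ x → IsAlmostCofinal I {y | y ∈ A ∧ (E : Set ℕ) ⊆ y}}

/-- A closed hereditary family of sets containing a tail of every member of `I`. -/
structure IsLarge (I : Order.Ideal (Set ℕ)) (F : Set (Set ℕ)) : Prop where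
  mono : ∀ x y, x ∈ F → y ⊆ x → y ∈ F
  closed : ∀ x, (∀ E : Finset ℕ, (E : Set ℕ) ⊆ x → (E : Set ℕ) ∈ F) → x ∈ F
  tail : ∀ x ∈ I, ∃ n, x \ Set.Iio n ∈ F

theorem StrictMono.exists_mem_Ico {k : ℕ → ℕ} (hk : StrictMono k) {n : ℕ} (hn : k 0 ≤ n) :
    ∃ i, k i ≤ n ∧ n < k (i + 1) := by
  have hex : ∃ i, n < k i := ⟨n + 1, (Nat.lt_succ_self n).trans_le hk.le_apply⟩
  obtain ⟨i, hi⟩ := Nat.exists_eq_succ_of_ne_zero (n := Nat.find hex) fun h0 =>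
    absurd (h0 ▸ Nat.find_spec hex) (not_lt.2 hn)
  refine ⟨i, not_lt.1 (Nat.find_min hex (by omega)), ?_⟩
  have := Nat.find_spec hex
  rwa [hi] at this

theorem ideal_union_mem {I : Order.Ideal (Set ℕ)} {x y : Set ℕ} (hx : x ∈ I) (hy : y ∈ I) :
    x ∪ y ∈ I :=
  Order.Ideal.sup_mem hx hy

theorem ideal_subset_mem {I : Order.Ideal (Set ℕ)} {x y : Set ℕ} (hx : x ∈ I) (h : y ⊆ x) :
    y ∈ I :=
  I.lower h hx

theorem ideal_finite_mem {I : Order.Ideal (Set ℕ)} {x : Set ℕ} (hx : x.Finite)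
    (h : ∀ n ∈ x, {n} ∈ I) : x ∈ I := by
  induction x, hx using Set.Finite.induction_on with
  | empty => exact I.bot_mem
  | @insert a s _ _ ih =>
    exact ideal_union_mem (h a (Set.mem_insert _ _)) (ih fun n hn => h n (Set.mem_insert_of_mem _ hn))

theorem almost_subset_trans {x y z : Set ℕ} (h : (x \ y).Finite) (h' : (y \ z).Finite) :
    (x \ z).Finite := by
  refine (h.union h').subset ?_
  rintro n ⟨h1, h2⟩
  by_cases h3 : n ∈ y
  · exact Or.inr ⟨h3, h2⟩
  · exact Or.inl ⟨h1, h3⟩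

/-- If each B j fails at some z j, a pseudo-union of the z j is almost covered by some member of A,
which lies in some B j: a contradiction. Cofinality thus survives countable partitions. -/
theorem IsPIdeal.exists_isAlmostCofinal {I : Order.Ideal (Set ℕ)} (hP : IsPIdeal I)
    {A : Set (Set ℕ)} (hA : IsAlmostCofinal I A) {B : ℕ → Set (Set ℕ)}
    (hAB : ∀ y ∈ A, ∃ j, y ∈ B j) : ∃ j, IsAlmostCofinal I (B j) := by
  by_contra h
  simp only [IsAlmostCofinal, not_exists, not_forall, not_and] at h
  choose z hz hzB using h
  obtain ⟨y, hy, hzy⟩ := hP z hz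
  obtain ⟨y', hy', hyy'⟩ := hA y hy
  obtain ⟨j, hj⟩ := hAB y' hy'
  exact hzB j y' hj (almost_subset_trans (hzy j) hyy')

theorem IsPIdeal.isLarge_cofinalTraces {I : Order.Ideal (Set ℕ)} (hP : IsPIdeal I)
    {A : Set (Set ℕ)} (hA : IsAlmostCofinal I A) : IsLarge I (cofinalTraces I A) where
  mono := fun x y hx hyx E hE => hx E (hE.trans hyx)
  closed := fun x h E hE => h E hE E subset_rfl
  tail := by
    intro x hx
    by_contra h
    simp only [not_exists] at h
    have h' : ∀ n, ∃ E : Finset ℕ, (E : Set ℕ) ⊆ x \ Set.Iio n ∧ ∃ z ∈ I,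
        ∀ y ∈ A, (E : Set ℕ) ⊆ y → ¬ (z \ y).Finite := by
      intro n
      have := h n
      by_contra hn
      refine this fun E hE z hz => ?_
      by_contra hc
      exact hn ⟨E, hE, z, hz, fun y hy hEy hf => hc ⟨y, ⟨hy, hEy⟩, hf⟩⟩
    choose E hE z hz hzA using h'
    -- A member y' of A almost containing x and all z n omits only finitely many points of x, so it
    -- contains E n for large n. This contradicts the choice of z n.
    obtain ⟨y, hy, hzy⟩ := hP z hz
    obtain ⟨y', hy', hyy'⟩ := hA (x ∪ y) (ideal_union_mem hx hy)
    have h1 : (x \ y').Finite := hyy'.subset (Set.sdiff_subset_sdiff_left Set.subset_union_left)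
    have h2 : (y \ y').Finite := hyy'.subset (Set.sdiff_subset_sdiff_left Set.subset_union_right)
    obtain ⟨N, hN⟩ := h1.bddAbove
    refine hzA (N + 1) y' hy' ?_ (almost_subset_trans (hzy (N + 1)) h2)
    intro m hm
    by_contra hmy
    have h3 := hE _ hm
    have h4 : m ≤ N := hN ⟨h3.1, hmy⟩
    exact h3.2 (Nat.lt_succ_of_le h4)

theorem IsLarge.inter {I : Order.Ideal (Set ℕ)} {F G : Set (Set ℕ)} (hF : IsLarge I F)
    (hG : IsLarge I G) : IsLarge I (F ∩ G) where
  mono := fun x y hx hyx => ⟨hF.mono x y hx.1 hyx, hG.mono x y hx.2 hyx⟩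
  closed := fun x h => ⟨hF.closed x fun E hE => (h E hE).1, hG.closed x fun E hE => (h E hE).2⟩
  tail := by
    intro x hx
    obtain ⟨n, hn⟩ := hF.tail x hx
    obtain ⟨m, hm⟩ := hG.tail x hx
    refine ⟨max n m, hF.mono _ _ hn ?_, hG.mono _ _ hm ?_⟩
    · exact Set.sdiff_subset_sdiff_right (Set.Iio_subset_Iio (le_max_left _ _))
    · exact Set.sdiff_subset_sdiff_right (Set.Iio_subset_Iio (le_max_right _ _))

theorem isLarge_subset_Ici (I : Order.Ideal (Set ℕ)) (n : ℕ) :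
    IsLarge I {x : Set ℕ | x ⊆ Set.Ici n} where
  mono := fun x y hx hyx => hyx.trans hx
  closed := by
    intro x h m hm
    have := h {m} (by simpa using hm)
    exact this (by simp)
  tail := fun x _ => ⟨n, fun m hm => Set.notMem_Iio.1 hm.2⟩

/-! ### Fusion along a parametrization of the ideal -/

section Fusion

/-- The values of `f` on the cylinder of the (reversed) string `s.1` which contain `s.2`. -/
def cylinderImage (f : (ℕ → ℕ) → Set ℕ) (s : List ℕ × Finset ℕ) : Set (Set ℕ) :=
  {y | ∃ β, PiNat.res β s.1.length = s.1 ∧ f β = y ∧ (s.2 : Set ℕ) ⊆ y}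

/-- The strings and finite sets with cofinal `cylinderImage`. -/
def CofinalNode (I : Order.Ideal (Set ℕ)) (f : (ℕ → ℕ) → Set ℕ) : Type :=
  {s : List ℕ × Finset ℕ // IsAlmostCofinal I (cylinderImage f s)}

variable {I : Order.Ideal (Set ℕ)} {f : (ℕ → ℕ) → Set ℕ}

/-- The large family of a cofinal node. -/
def CofinalNode.traces (s : CofinalNode I f) : Set (Set ℕ) :=
  cofinalTraces I (cylinderImage f s.1)

/-- `s'` extends the string of `s` by one entry, and the finite set of `s` by `E`. -/
def CofinalNode.Step (s : CofinalNode I f) (E : Finset ℕ) (s' : CofinalNode I f) : Prop :=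
  (∃ a, s'.1.1 = a :: s.1.1) ∧ s.1.2 ⊆ s'.1.2 ∧ E ⊆ s'.1.2

/-- The node of the empty string and the empty set. -/
def CofinalNode.root (hf : ∀ x, x ∈ I ↔ x ∈ Set.range f) : CofinalNode I f :=
  ⟨([], ∅), fun x hx => by
    obtain ⟨β, rfl⟩ := (hf x).1 hx
    exact ⟨f β, ⟨β, rfl, rfl, by simp⟩, by simp⟩⟩

theorem CofinalNode.exists_step (hP : IsPIdeal I) (s : CofinalNode I f) {E : Finset ℕ}
    (hE : (E : Set ℕ) ∈ s.traces) : ∃ s' : CofinalNode I f, s.Step E s' := by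
  obtain ⟨j, hj⟩ := hP.exists_isAlmostCofinal (hE E subset_rfl)
    (B := fun j => cylinderImage f (j :: s.1.1, s.1.2 ∪ E)) (by
      rintro _ ⟨⟨β, hβ, rfl, hs⟩, hE'⟩
      refine ⟨β s.1.1.length, β, ?_, rfl, ?_⟩
      · simp only [List.length_cons, PiNat.res_succ]
        rw [hβ]
      · simp only [Finset.coe_union]
        exact Set.union_subset hs hE')
  exact ⟨⟨_, hj⟩, ⟨j, rfl⟩, Finset.subset_union_left, Finset.subset_union_right⟩

/-- The strings converge to a branch a, and f a is the set sought: whether m ∈ f a is decided by an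
initial segment of a, and later nodes share that segment with parameters whose values contain m. -/
theorem CofinalNode.exists_limit (hf : ∀ x, x ∈ I ↔ x ∈ Set.range f)
    (hcont : ∀ β m, ∃ n, ∀ γ ∈ PiNat.cylinder β n, (m ∈ f γ ↔ m ∈ f β))
    (s : ℕ → CofinalNode I f) (h0 : (s 0).1.1 = []) (E : ℕ → Finset ℕ)
    (hs : ∀ i, (s i).Step (E i) (s (i + 1))) : ∃ y ∈ I, ∀ i, (E i : Set ℕ) ⊆ y := by
  choose a ha using fun i => (hs i).1
  have hmono : Monotone fun i => (s i).1.2 := monotone_nat_of_le_succ fun i => (hs i).2.1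
  have hres : ∀ i, PiNat.res a i = (s i).1.1 := by
    intro i
    induction i with
    | zero => simp [h0]
    | succ i ih => rw [PiNat.res_succ, ih, ha]
  refine ⟨f a, (hf _).2 ⟨a, rfl⟩, fun i m hm => ?_⟩
  obtain ⟨n, hn⟩ := hcont a m
  -- Cofinality is tested at ∅ merely to see that the cylinder image is nonempty.
  obtain ⟨y, ⟨β, hβ, rfl, hβs⟩, -⟩ := (s (max n (i + 1))).2 ∅ I.bot_mem
  have hlen : (s (max n (i + 1))).1.1.length = max n (i + 1) := by
    rw [← hres, PiNat.res_length]
  rw [hlen, ← hres] at hβ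
  refine (hn β ?_).1 (hβs (hmono (le_max_right n (i + 1)) ((hs i).2.2 hm)))
  refine PiNat.cylinder_anti a (le_max_left n (i + 1)) ?_
  rw [PiNat.cylinder_eq_res]
  exact hβ

/-- Otherwise two parallel fusions yield y, y' ∈ I such that y ∪ y' contains finite sets outside F
beyond every n, so no tail of y ∪ y' is in F. -/
theorem IsLarge.exists_union_subset (hP : IsPIdeal I) (hf : ∀ x, x ∈ I ↔ x ∈ Set.range f)
    (hcont : ∀ β m, ∃ n, ∀ γ ∈ PiNat.cylinder β n, (m ∈ f γ ↔ m ∈ f β))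
    {F : Set (Set ℕ)} (hF : IsLarge I F) :
    ∃ G, IsLarge I G ∧ ∀ x ∈ G, ∀ y ∈ G, x ∪ y ∈ F := by
  by_contra hno
  have key : ∀ (n : ℕ) (s s' : CofinalNode I f), ∃ E E' : Finset ℕ, (E : Set ℕ) ∈ s.traces ∧
      (E' : Set ℕ) ∈ s'.traces ∧ (E : Set ℕ) ⊆ Set.Ici n ∧ (E' : Set ℕ) ⊆ Set.Ici n ∧
      ((E : Set ℕ) ∪ E' : Set ℕ) ∉ F := by
    intro n s s'
    -- If no such pair exists, the common traces of s and s' inside [n, ∞) form a valid G, because F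
    -- is closed.
    by_contra hc
    have hs := hP.isLarge_cofinalTraces s.2
    have hs' := hP.isLarge_cofinalTraces s'.2
    refine hno ⟨_, (hs.inter hs').inter (isLarge_subset_Ici I n), ?_⟩
    intro x hx y hy
    refine hF.closed _ fun E hE => ?_
    by_contra hEF
    classical
    have hEu : ((E.filter (· ∈ x) : Finset ℕ) : Set ℕ) ∪ (E.filter (· ∈ y) : Finset ℕ) = E := by
      ext m
      simp only [Set.mem_union, Finset.mem_coe, Finset.mem_filter]
      constructor
      · rintro (h | h) <;> exact h.1
      · intro h
        rcases hE h with h' | h'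
        · exact Or.inl ⟨h, h'⟩
        · exact Or.inr ⟨h, h'⟩
    have hxs : ((E.filter (· ∈ x) : Finset ℕ) : Set ℕ) ⊆ x := by
      intro m hm
      exact (Finset.mem_filter.1 hm).2
    have hys : ((E.filter (· ∈ y) : Finset ℕ) : Set ℕ) ⊆ y := by
      intro m hm
      exact (Finset.mem_filter.1 hm).2
    exact hc ⟨E.filter (· ∈ x), E.filter (· ∈ y), hs.mono _ _ hx.1.1 hxs,
      hs'.mono _ _ hy.1.2 hys, hxs.trans hx.2, hys.trans hy.2, by rwa [hEu]⟩
  choose E E' h1 h2 h3 h4 h5 using key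
  choose g hg using fun (p : CofinalNode I f × Finset ℕ) (h : (p.2 : Set ℕ) ∈ p.1.traces) =>
    CofinalNode.exists_step hP p.1 h
  let S : ℕ → CofinalNode I f × CofinalNode I f := fun n => Nat.rec
    (CofinalNode.root hf, CofinalNode.root hf)
    (fun n s => (g (s.1, E n s.1 s.2) (h1 _ _ _), g (s.2, E' n s.1 s.2) (h2 _ _ _))) n
  obtain ⟨y, hy, hEy⟩ := CofinalNode.exists_limit hf hcont (fun i => (S i).1) rfl
    (fun i => E i (S i).1 (S i).2) (fun i => hg ((S i).1, E i (S i).1 (S i).2) (h1 _ _ _))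
  obtain ⟨y', hy', hEy'⟩ := CofinalNode.exists_limit hf hcont (fun i => (S i).2) rfl
    (fun i => E' i (S i).1 (S i).2) (fun i => hg ((S i).2, E' i (S i).1 (S i).2) (h2 _ _ _))
  obtain ⟨n, hn⟩ := hF.tail _ (ideal_union_mem hy hy')
  refine h5 n (S n).1 (S n).2 (hF.mono _ _ hn ?_)
  rintro m (hm | hm)
  · exact ⟨Or.inl (hEy n hm), Set.notMem_Iio.2 (h3 _ _ _ hm)⟩
  · exact ⟨Or.inr (hEy' n hm), Set.notMem_Iio.2 (h4 _ _ _ hm)⟩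

/-- Cut x into consecutive finite pieces; one fusion absorbs the even pieces, another the odd ones,
and x is covered by the two limits and a finite set. -/
theorem mem_of_forall_traces (hP : IsPIdeal I) (hf : ∀ x, x ∈ I ↔ x ∈ Set.range f)
    (hcont : ∀ β m, ∃ n, ∀ γ ∈ PiNat.cylinder β n, (m ∈ f γ ↔ m ∈ f β))
    {x : Set ℕ} (hx : ∀ n ∈ x, {n} ∈ I)
    (h : ∀ s : CofinalNode I f, ∃ n, x \ Set.Iio n ∈ s.traces) : x ∈ I := by
  classical
  choose N hN using h
  -- A state holds a position, the active node and the waiting node. A piece must end beyond the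
  -- threshold of the node that acts next, but a new node is known only after its piece; alternating
  -- two nodes removes the circularity.
  let T := {p : ℕ × CofinalNode I f × CofinalNode I f // x \ Set.Iio p.1 ∈ p.2.1.traces}
  have htr : ∀ (s : CofinalNode I f) (n m : ℕ), n ≤ m → x \ Set.Iio n ∈ s.traces →
      x \ Set.Iio m ∈ s.traces := fun s n m hnm hs =>
    (hP.isLarge_cofinalTraces s.2).mono _ _ hs
      (Set.sdiff_subset_sdiff_right (Set.Iio_subset_Iio hnm))
  have key : ∀ p : T, ∃ q : T, p.1.1 < q.1.1 ∧ q.1.2.1 = p.1.2.2 ∧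
      p.1.2.1.Step ((Finset.Ico p.1.1 q.1.1).filter (· ∈ x)) q.1.2.2 := by
    rintro ⟨⟨n, s, s'⟩, hs⟩
    set n' := max (n + 1) (N s') with hn'
    obtain ⟨s₁, hs₁⟩ := s.exists_step hP (E := (Finset.Ico n n').filter (· ∈ x))
      ((hP.isLarge_cofinalTraces s.2).mono _ _ hs (by
        intro m hm
        have := Finset.mem_filter.1 hm
        exact ⟨this.2, not_lt.mpr (Finset.mem_Ico.1 this.1).1⟩))
    exact ⟨⟨⟨n', s', s₁⟩, htr _ _ _ (le_max_right _ _) (hN s')⟩,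
      lt_of_lt_of_le (Nat.lt_succ_self n) (le_max_left _ _), rfl, hs₁⟩
  choose g hg1 hg2 hg3 using key
  let S : ℕ → T := fun n => Nat.rec
    ⟨⟨N (CofinalNode.root hf), CofinalNode.root hf, CofinalNode.root hf⟩, hN _⟩ (fun _ p => g p) n
  let E : ℕ → Finset ℕ := fun i => (Finset.Ico (S i).1.1 (S (i + 1)).1.1).filter (· ∈ x)
  have hstep : ∀ i, (S i).1.2.1.Step (E i) (S (i + 2)).1.2.1 := by
    intro i
    have h1 : (S (i + 2)).1.2.1 = (S (i + 1)).1.2.2 := hg2 (S (i + 1))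
    rw [h1]
    exact hg3 (S i)
  have hn : StrictMono fun i => (S i).1.1 := strictMono_nat_of_lt_succ fun i => hg1 (S i)
  obtain ⟨y, hy, hEy⟩ := CofinalNode.exists_limit hf hcont (fun i => (S (2 * i)).1.2.1) rfl
    (fun i => E (2 * i)) (fun i => hstep (2 * i))
  obtain ⟨y', hy', hEy'⟩ := CofinalNode.exists_limit hf hcont (fun i => (S (2 * i + 1)).1.2.1)
    (by
      have : (S 1).1.2.1 = (S 0).1.2.2 := hg2 (S 0)
      simp only [mul_zero, zero_add]
      rw [this]
      rfl)
    (fun i => E (2 * i + 1)) (fun i => hstep (2 * i + 1))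
  have hfin : x ∩ Set.Iio (S 0).1.1 ∈ I :=
    ideal_finite_mem ((Set.finite_Iio _).subset Set.inter_subset_right) fun n hn => hx n hn.1
  refine ideal_subset_mem (ideal_union_mem hfin (ideal_union_mem hy hy')) ?_
  intro m hm
  by_cases hm0 : m < (S 0).1.1
  · exact Or.inl ⟨hm, hm0⟩
  right
  obtain ⟨i, h2, h1⟩ := hn.exists_mem_Ico (not_lt.1 hm0)
  have hmE : m ∈ E i := Finset.mem_filter.2 ⟨Finset.mem_Ico.2 ⟨h2, h1⟩, hm⟩
  rcases Nat.even_or_odd' i with ⟨j, rfl | rfl⟩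
  · exact Or.inl (hEy j hmE)
  · exact Or.inr (hEy' j hmE)

end Fusion

/-! ### Exhaustion of a Borel P-ideal -/

instance (I : Order.Ideal (Set ℕ)) (f : (ℕ → ℕ) → Set ℕ) : Countable (CofinalNode I f) :=
  inferInstanceAs (Countable {s : List ℕ × Finset ℕ // IsAlmostCofinal I (cylinderImage f s)})

theorem IsBorelIdeal.exists_parametrization {I : Order.Ideal (Set ℕ)} (hI : IsBorelIdeal I) :
    ∃ f : (ℕ → ℕ) → Set ℕ, (∀ x, x ∈ I ↔ x ∈ Set.range f) ∧
      ∀ β m, ∃ n, ∀ γ ∈ PiNat.cylinder β n, (m ∈ f γ ↔ m ∈ f β) := by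
  have hmeas : Measurable fun x : ℕ → Bool => {n | x n = true} :=
    measurable_set_iff.2 fun n => measurableSet_setOfPred.1 (by
      exact measurableSet_eq_fun (measurable_pi_apply n) measurable_const)
  have : PolishSpace (ℕ → Bool) := {}
  have hA : MeasureTheory.AnalyticSet {x : ℕ → Bool | {n | x n = true} ∈ I} :=
    MeasurableSet.analyticSet (hmeas hI)
  rw [MeasureTheory.AnalyticSet] at hA
  rcases hA with h | ⟨g, hg, hrange⟩
  · exfalso
    have : (fun _ => false) ∈ {x : ℕ → Bool | {n | x n = true} ∈ I} := by
      have h0 : {n : ℕ | (fun _ : ℕ => false) n = true} = ∅ := by simp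
      show {n : ℕ | (fun _ : ℕ => false) n = true} ∈ I
      rw [h0]
      exact I.bot_mem
    rw [h] at this
    exact this
  · refine ⟨fun β => {n | g β n = true}, fun x => ?_, fun β m => ?_⟩
    · constructor
      · intro hx
        classical
        have hx' : {n | (fun n => decide (n ∈ x)) n = true} = x := by ext; simp
        have : (fun n => decide (n ∈ x)) ∈ Set.range g := by
          rw [hrange]
          show {n | (fun n => decide (n ∈ x)) n = true} ∈ I
          rwa [hx']
        obtain ⟨β, hβ⟩ := this
        refine ⟨β, ?_⟩
        simp only [hβ]
        exact hx'
      · rintro ⟨β, rfl⟩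
        have : g β ∈ Set.range g := ⟨β, rfl⟩
        rw [hrange] at this
        exact this
    · have hopen : IsOpen {γ : ℕ → ℕ | g γ m = g β m} :=
        (isOpen_discrete {g β m}).preimage ((continuous_apply m).comp hg)
      obtain ⟨_, ⟨δ, n, rfl⟩, hβ, hsub⟩ :=
        (PiNat.isTopologicalBasis_cylinders (fun _ : ℕ => ℕ)).exists_subset_of_mem_open
          (show β ∈ {γ : ℕ → ℕ | g γ m = g β m} from rfl) hopen
      refine ⟨n, fun γ hγ => ?_⟩
      rw [← PiNat.mem_cylinder_iff_eq.1 hβ] at hsub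
      have : g γ m = g β m := hsub hγ
      show g γ m = true ↔ g β m = true
      rw [this]

/-- A Borel P-ideal is the ideal of all sets which have tails in every member of a sequence of
large families, each of which contains the pairwise unions of members of the next one. -/
theorem IsPIdeal.exists_exhaustion {I : Order.Ideal (Set ℕ)} (hI : IsBorelIdeal I)
    (hP : IsPIdeal I) : ∃ F : ℕ → Set (Set ℕ), (∀ i, IsLarge I (F i)) ∧
      (∀ i, ∀ x ∈ F (i + 1), ∀ y ∈ F (i + 1), x ∪ y ∈ F i) ∧
      ∀ x : Set ℕ, (∀ n ∈ x, {n} ∈ I) → (∀ i, ∃ n, x \ Set.Iio n ∈ F i) → x ∈ I := by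
  obtain ⟨f, hf, hcont⟩ := hI.exists_parametrization
  have : Nonempty (CofinalNode I f) := ⟨CofinalNode.root hf⟩
  obtain ⟨e, he⟩ := exists_surjective_nat (CofinalNode I f)
  choose g hg1 hg2 using fun F : {F // IsLarge I F} => F.2.exists_union_subset hP hf hcont
  -- Each stage halves the previous family and intersects with the traces of the next enumerated
  -- node, so tails in all L i give tails in the traces of every node.
  let L : ℕ → {F // IsLarge I F} := fun n => Nat.rec
    ⟨_, hP.isLarge_cofinalTraces (e 0).2⟩
    (fun n F => ⟨g F ∩ cofinalTraces I (cylinderImage f (e (n + 1)).1),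
      (hg1 F).inter (hP.isLarge_cofinalTraces (e (n + 1)).2)⟩) n
  refine ⟨fun i => (L i).1, fun i => (L i).2, fun i x hx y hy => hg2 (L i) x hx.1 y hy.1, ?_⟩
  intro x hx h
  refine mem_of_forall_traces hP hf hcont hx fun s => ?_
  obtain ⟨i, rfl⟩ := he s
  obtain ⟨n, hn⟩ := h i
  refine ⟨n, ?_⟩
  cases i with
  | zero => exact hn
  | succ i => exact hn.2

/-! ### Baire category: continuity on an invariant dense Gδ -/

theorem tendsto_flip_residual (E : Finset ℕ) :
    Tendsto (fun (x : ℕ → Bool) n => xor (decide (n ∈ E)) (x n)) (residual _) (residual _) := by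
  have hc : Continuous fun (x : ℕ → Bool) n => xor (decide (n ∈ E)) (x n) := by
    refine continuous_pi fun n => ?_
    exact (continuous_of_discreteTopology (f := xor (decide (n ∈ E)))).comp (continuous_apply n)
  have hinv : Function.Involutive fun (x : ℕ → Bool) n => xor (decide (n ∈ E)) (x n) := by
    intro x
    ext n
    simp
  let h : (ℕ → Bool) ≃ₜ (ℕ → Bool) := ⟨hinv.toPerm, hc, hc⟩
  exact tendsto_residual_of_isOpenMap hc h.isOpenMap

/-- A measurable map on the Cantor space is continuous on a dense `Gδ` set which is invariant under
finite changes. -/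
theorem Measurable.exists_invariant_continuousOn {θ : (ℕ → Bool) → Set ℕ} (hθ : Measurable θ) :
    ∃ C : Set (ℕ → Bool), IsGδ C ∧ Dense C ∧
      (∀ x ∈ C, ∀ y : ℕ → Bool, {n | x n ≠ y n}.Finite → y ∈ C) ∧
      ∀ x ∈ C, ∀ m : ℕ, ∃ a : ℕ, ∀ y ∈ C, (∀ n < a, y n = x n) →
        ∀ j < m, (j ∈ θ y ↔ j ∈ θ x) := by
  -- Both the condition j ∈ θ x and its negation are approximated by open sets, so that either
  -- answer is locally constant on a comeager set.
  have hU : ∀ j, ∃ U : Set (ℕ → Bool), IsOpen U ∧ {x | j ∈ θ x} =ᶠ[residual _] U := fun j =>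
    MeasurableSet.residualEq_isOpen (measurableSet_setOfPred.2 (measurable_set_iff.1 hθ j))
  have hV : ∀ j, ∃ V : Set (ℕ → Bool), IsOpen V ∧ {x | j ∈ θ x}ᶜ =ᶠ[residual _] V := fun j =>
    MeasurableSet.residualEq_isOpen
      (measurableSet_setOfPred.2 (measurable_set_iff.1 hθ j)).compl
  choose U hUo hU using hU
  choose V hVo hV using hV
  have hD : ∀ᶠ x in residual (ℕ → Bool), ∀ j, (j ∈ θ x ↔ x ∈ U j) ∧ (j ∉ θ x ↔ x ∈ V j) := by
    rw [eventually_countable_forall]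
    intro j
    filter_upwards [(hU j).mem_iff, (hV j).mem_iff] with x h1 h2
    exact ⟨h1, h2⟩
  obtain ⟨C₀, hG, hd, hC₀⟩ := eventually_residual.1 hD
  have hres : ∀ᶠ x in residual (ℕ → Bool), ∀ E : Finset ℕ,
      (fun n => xor (decide (n ∈ E)) (x n)) ∈ C₀ := by
    rw [eventually_countable_forall]
    exact fun E => (tendsto_flip_residual E).eventually (residual_of_dense_Gδ hG hd)
  -- Intersecting all finite flips of C₀ gives invariance under finite changes.
  refine ⟨{x | ∀ E : Finset ℕ, (fun n => xor (decide (n ∈ E)) (x n)) ∈ C₀}, ?_,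
    dense_of_mem_residual hres, ?_, ?_⟩
  · have : {x : ℕ → Bool | ∀ E : Finset ℕ, (fun n => xor (decide (n ∈ E)) (x n)) ∈ C₀} =
        ⋂ E : Finset ℕ, (fun (x : ℕ → Bool) n => xor (decide (n ∈ E)) (x n)) ⁻¹' C₀ := by
      ext x
      simp
    rw [this]
    refine IsGδ.iInter fun E => hG.preimage (continuous_pi fun n => ?_)
    exact (continuous_of_discreteTopology (f := xor (decide (n ∈ E)))).comp (continuous_apply n)
  · intro x hx y hxy E
    have hfin : {n | x n ≠ xor (decide (n ∈ E)) (y n)}.Finite := by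
      refine (hxy.union E.finite_toSet).subset fun n hn => ?_
      by_cases hnE : n ∈ E
      · exact Or.inr hnE
      · left
        have hn' : x n ≠ xor (decide (n ∈ E)) (y n) := hn
        simpa [hnE] using hn'
    have := hx hfin.toFinset
    convert this using 1
    ext n
    by_cases h : x n = xor (decide (n ∈ E)) (y n)
    · simp [h]
    · have h' : decide (n ∈ hfin.toFinset) = true := by simpa using h
      rw [h']
      revert h
      cases x n <;> cases (xor (decide (n ∈ E)) (y n)) <;> simp
  · intro x hx m
    have hsub : ∀ x : ℕ → Bool, (∀ E : Finset ℕ, (fun n => xor (decide (n ∈ E)) (x n)) ∈ C₀) →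
        x ∈ C₀ := by
      intro x hx
      simpa using hx ∅
    have hone : ∀ j, ∃ W, IsOpen W ∧ x ∈ W ∧ ∀ y ∈ C₀, y ∈ W → (j ∈ θ y ↔ j ∈ θ x) := by
      intro j
      have hx₀ := hC₀ x (hsub x hx) j
      by_cases hj : j ∈ θ x
      · exact ⟨U j, hUo j, hx₀.1.1 hj, fun y hy hyU => by simp [hj, (hC₀ y hy j).1.2 hyU]⟩
      · exact ⟨V j, hVo j, hx₀.2.1 hj, fun y hy hyV => by simp [hj, (hC₀ y hy j).2.2 hyV]⟩
    choose W hWo hxW hW using hone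
    obtain ⟨_, ⟨δ, n, rfl⟩, hxδ, hsub'⟩ :=
      (PiNat.isTopologicalBasis_cylinders (fun _ : ℕ => Bool)).exists_subset_of_mem_open
        (show x ∈ ⋂ j ∈ Finset.range m, W j by simp [hxW])
        (isOpen_biInter_finset fun j _ => hWo j)
    refine ⟨n, fun y hy hyx j hj => hW j y (hsub y hy) ?_⟩
    rw [← PiNat.mem_cylinder_iff_eq.1 hxδ] at hsub'
    have hyW := hsub' (PiNat.mem_cylinder_iff.2 hyx)
    simp only [Set.mem_iInter] at hyW
    exact hyW j (Finset.mem_range.2 hj)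

/-! ### Stabilizing strings -/

/-- The points which agree with `x` from `b` on. -/
def tailClass (b : ℕ) (x : ℕ → Bool) : Set (ℕ → Bool) :=
  {y | ∀ n, b ≤ n → y n = x n}

theorem finite_tailClass (b : ℕ) (x : ℕ → Bool) : (tailClass b x).Finite := by
  refine Set.Finite.of_injOn (f := fun (y : ℕ → Bool) (n : Fin b) => y n) (t := Set.univ)
    (fun _ _ => Set.mem_univ _) ?_ Set.finite_univ
  intro y hy z hz h
  ext n
  by_cases hn : n < b
  · exact congrFun h ⟨n, hn⟩
  · rw [hy n (not_lt.1 hn), hz n (not_lt.1 hn)]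

theorem finite_ne_of_mem_tailClass {b : ℕ} {x y : ℕ → Bool} (h : y ∈ tailClass b x) :
    {n | x n ≠ y n}.Finite := by
  refine (Set.finite_Iio b).subset fun n hn => ?_
  by_contra hb
  exact hn (h n (not_lt.1 hb)).symm

/-- The union of all `θ y ∆ θ z` where `y` and `z` agree with `x` from `b` on. -/
def tailVariation (θ : (ℕ → Bool) → Set ℕ) (b : ℕ) (x : ℕ → Bool) : Set ℕ :=
  ⋃ y ∈ tailClass b x, ⋃ z ∈ tailClass b x, symmDiff (θ y) (θ z)

theorem ideal_biUnion_mem {ι : Type*} {J : Order.Ideal (Set ℕ)} {s : Set ι} (hs : s.Finite)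
    {A : ι → Set ℕ} (h : ∀ i ∈ s, A i ∈ J) : ⋃ i ∈ s, A i ∈ J := by
  induction s, hs using Set.Finite.induction_on with
  | empty => simpa using J.bot_mem
  | @insert a s _ _ ih =>
    rw [Set.biUnion_insert]
    exact ideal_union_mem (h a (Set.mem_insert _ _)) (ih fun n hn => h n (Set.mem_insert_of_mem _ hn))

theorem tailVariation_mem {J : Order.Ideal (Set ℕ)} {θ : (ℕ → Bool) → Set ℕ}
    (hθ : ∀ x y : ℕ → Bool, {n | x n ≠ y n}.Finite → symmDiff (θ x) (θ y) ∈ J)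
    (b : ℕ) (x : ℕ → Bool) : tailVariation θ b x ∈ J := by
  refine ideal_biUnion_mem (finite_tailClass b x) fun y hy =>
    ideal_biUnion_mem (finite_tailClass b x) fun z hz => hθ y z ?_
  refine finite_ne_of_mem_tailClass (b := b) fun n hn => ?_
  rw [hz n hn, hy n hn]

theorem tailVariation_congr {θ : (ℕ → Bool) → Set ℕ} {b : ℕ} {x y : ℕ → Bool}
    (h : y ∈ tailClass b x) : tailVariation θ b x = tailVariation θ b y := by
  have : tailClass b x = tailClass b y := by
    ext z
    refine forall₂_congr fun n hn => ?_
    rw [h n hn]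
  unfold tailVariation
  rw [this]

/-- `x` below `b`, and `y` from `b` on. -/
def splice (b : ℕ) (x y : ℕ → Bool) : ℕ → Bool := fun n => if n < b then x n else y n

theorem splice_of_lt {b n : ℕ} (h : n < b) (x y : ℕ → Bool) : splice b x y n = x n := if_pos h

theorem splice_mem_tailClass (b : ℕ) (x y : ℕ → Bool) : splice b x y ∈ tailClass b y :=
  fun _ hn => if_neg (not_lt.2 hn)

theorem Set.Finite.exists_forall_nat_bound {α : Type*} {s : Set α} (hs : s.Finite)
    {P : α → ℕ → Prop} (hP : ∀ x ∈ s, ∃ a, P x a) (hmono : ∀ x a a', a ≤ a' → P x a → P x a') :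
    ∃ a, ∀ x ∈ s, P x a := by
  have : ∀ x, ∃ a, x ∈ s → P x a := fun x => by
    by_cases hx : x ∈ s
    · obtain ⟨a, ha⟩ := hP x hx
      exact ⟨a, fun _ => ha⟩
    · exact ⟨0, fun h => absurd h hx⟩
  choose f hf using this
  obtain ⟨N, hN⟩ := (hs.image f).bddAbove
  exact ⟨N, fun x hx => hmono x _ _ (hN ⟨x, hx, rfl⟩) (hf x hx)⟩

/-- A finite string `s ↾ [b, a)` that stabilizes `θ`. -/
theorem exists_stabilizer {J : Order.Ideal (Set ℕ)} {θ : (ℕ → Bool) → Set ℕ}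
    (hθ : ∀ x y : ℕ → Bool, {n | x n ≠ y n}.Finite → symmDiff (θ x) (θ y) ∈ J)
    {C : Set (ℕ → Bool)} (hG : IsGδ C) (hd : Dense C)
    (hinv : ∀ x ∈ C, ∀ y : ℕ → Bool, {n | x n ≠ y n}.Finite → y ∈ C)
    (hcont : ∀ x ∈ C, ∀ m : ℕ, ∃ a : ℕ, ∀ y ∈ C, (∀ n < a, y n = x n) →
        ∀ j < m, (j ∈ θ y ↔ j ∈ θ x))
    {F : Set (Set ℕ)} (hF : IsLarge J F) {O : Set (ℕ → Bool)} (hO : IsOpen O) (hCO : C ⊆ O)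
    (b K : ℕ) : ∃ k a : ℕ, ∃ s : ℕ → Bool, K ≤ k ∧ b < a ∧
      (∀ x ∈ C, (∀ n, b ≤ n → n < a → x n = s n) → tailVariation θ b x \ Set.Iio k ∈ F) ∧
      (∀ x ∈ C, ∀ y ∈ C, (∀ n, b ≤ n → n < a → x n = s n) → (∀ n, b ≤ n → n < a → y n = s n) →
        (∀ n < b, x n = y n) → ∀ j < k, (j ∈ θ x ↔ j ∈ θ y)) ∧
      (∀ x, (∀ n, b ≤ n → n < a → x n = s n) → x ∈ O) := by
  have htail : ∀ x ∈ C, ∀ y ∈ tailClass b x, y ∈ C := fun x hx y hy =>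
    hinv x hx y (finite_ne_of_mem_tailClass hy)
  have hcyl : ∀ (V : Set (ℕ → Bool)), IsOpen V → ∀ x ∈ V, ∃ a, PiNat.cylinder x a ⊆ V := by
    intro V hV x hx
    obtain ⟨_, ⟨δ, n, rfl⟩, hxδ, hsub⟩ :=
      (PiNat.isTopologicalBasis_cylinders (fun _ : ℕ => Bool)).exists_subset_of_mem_open hx hV
    rw [← PiNat.mem_cylinder_iff_eq.1 hxδ] at hsub
    exact ⟨n, hsub⟩
  let P : ℕ → Set (ℕ → Bool) := fun k => {x | x ∈ C ∧ tailVariation θ b x \ Set.Iio k ∈ F}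
  -- `P k` is relatively closed in C: the tail class is finite, so on a finite set E the variation
  -- of x is reproduced by any z ∈ C close enough to x.
  have hclosed : ∀ k, ∀ x ∈ C, x ∈ closure (P k) → x ∈ P k := by
    intro k x hx hxP
    refine ⟨hx, hF.closed _ fun E hE => ?_⟩
    obtain ⟨a, ha⟩ := (finite_tailClass b x).exists_forall_nat_bound
      (P := fun y a => ∀ z ∈ C, (∀ n < a, z n = y n) → ∀ j < E.sup id + 1, (j ∈ θ z ↔ j ∈ θ y))
      (fun y hy => hcont y (htail x hx y hy) _)
      (fun y a a' haa' h z hz hzy => h z hz fun n hn => hzy n (hn.trans_le haa'))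
    obtain ⟨z, hzx, hzC, hzF⟩ := mem_closure_iff.1 hxP _ (PiNat.isOpen_cylinder _ x a)
      (PiNat.self_mem_cylinder x a)
    refine hF.mono _ _ hzF fun j hj => ?_
    obtain ⟨hjo, hjk⟩ := hE hj
    refine ⟨?_, hjk⟩
    have hjE : j < E.sup id + 1 := Nat.lt_succ_of_le (Finset.le_sup (f := id) hj)
    have hsp : ∀ y ∈ tailClass b x, (j ∈ θ (splice b y z) ↔ j ∈ θ y) := by
      intro y hy
      refine ha y hy _ (htail z hzC _ (splice_mem_tailClass b y z)) (fun n hn => ?_) j hjE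
      by_cases hnb : n < b
      · exact splice_of_lt hnb _ _
      · rw [splice_mem_tailClass b y z n (not_lt.1 hnb), hy n (not_lt.1 hnb)]
        exact hzx n hn
    simp only [tailVariation, Set.mem_iUnion] at hjo ⊢
    obtain ⟨y, hy, y', hy', h⟩ := hjo
    refine ⟨_, splice_mem_tailClass b y z, _, splice_mem_tailClass b y' z, ?_⟩
    rw [Set.mem_symmDiff] at h ⊢
    rwa [hsp y hy, hsp y' hy']
  -- The sets `P k` cover C, so by Baire some closure has interior.
  have hdense := hG.dense_iUnion_interior_of_closed hd (f := fun k => closure (P k))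
    (fun k => isClosed_closure) (fun x hx => by
      obtain ⟨k, hk⟩ := hF.tail _ (tailVariation_mem hθ b x)
      exact Set.mem_iUnion.2 ⟨k, subset_closure ⟨hx, hk⟩⟩)
  obtain ⟨x₀, hx₀⟩ := hdense.nonempty
  obtain ⟨k, hk⟩ := Set.mem_iUnion.1 hx₀
  obtain ⟨s, hsk, hsC⟩ := hd.inter_open_nonempty _ isOpen_interior ⟨x₀, hk⟩
  obtain ⟨a₀, ha₀⟩ := hcyl _ isOpen_interior s hsk
  -- The string has to work after every prefix of length b, hence the uniform bound over the finite
  -- tail class of s.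
  obtain ⟨a₁, ha₁⟩ := (finite_tailClass b s).exists_forall_nat_bound
    (P := fun y a => ∀ z : ℕ → Bool, (∀ n < a, z n = y n) → z ∈ O)
    (fun y hy => by
      obtain ⟨a, ha⟩ := hcyl O hO y (hCO (htail s hsC y hy))
      exact ⟨a, fun z hz => ha (PiNat.mem_cylinder_iff.2 hz)⟩)
    (fun y a a' haa' h z hzy => h z fun n hn => hzy n (hn.trans_le haa'))
  obtain ⟨a₂, ha₂⟩ := (finite_tailClass b s).exists_forall_nat_bound
    (P := fun y a => ∀ z ∈ C, (∀ n < a, z n = y n) → ∀ j < max K k, (j ∈ θ z ↔ j ∈ θ y))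
    (fun y hy => hcont y (htail s hsC y hy) _)
    (fun y a a' haa' h z hz hzy => h z hz fun n hn => hzy n (hn.trans_le haa'))
  have hagree : ∀ x y : ℕ → Bool,
      (∀ n, b ≤ n → n < max (max a₀ (b + 1)) (max a₁ a₂) → x n = s n) → (∀ n < b, x n = y n) →
      ∀ n < max (max a₀ (b + 1)) (max a₁ a₂), x n = splice b y s n := by
    intro x y hxs hxy n hn
    by_cases hnb : n < b
    · rw [splice_of_lt hnb, hxy n hnb]
    · rw [splice_mem_tailClass b y s n (not_lt.1 hnb), hxs n (not_lt.1 hnb) hn]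
  refine ⟨max K k, max (max a₀ (b + 1)) (max a₁ a₂), s, le_max_left _ _, ?_, ?_, ?_, ?_⟩
  · exact lt_of_lt_of_le (Nat.lt_succ_self b) ((le_max_right _ _).trans (le_max_left _ _))
  · intro x hx hxs
    -- The variation ignores coordinates below b, so the prefix may be replaced by that of s, which
    -- lands in the cylinder found above.
    rw [tailVariation_congr (splice_mem_tailClass b s x)]
    have h1 : splice b s x ∈ P k := by
      refine hclosed k _ (htail x hx _ (splice_mem_tailClass b s x)) (interior_subset (ha₀ ?_))
      intro n hn
      by_cases hnb : n < b
      · exact splice_of_lt hnb _ _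
      · rw [splice_mem_tailClass b s x n (not_lt.1 hnb)]
        exact hxs n (not_lt.1 hnb) (hn.trans_le ((le_max_left _ _).trans (le_max_left _ _)))
    exact hF.mono _ _ h1.2
      (Set.sdiff_subset_sdiff_right (Set.Iio_subset_Iio (le_max_right _ _)))
  · intro x hx y hy hxs hys hxy j hj
    have hle : a₂ ≤ max (max a₀ (b + 1)) (max a₁ a₂) := (le_max_right _ _).trans (le_max_right _ _)
    rw [ha₂ _ (splice_mem_tailClass b y s) x hx
        (fun n hn => hagree x y hxs hxy n (hn.trans_le hle)) j hj,
      ha₂ _ (splice_mem_tailClass b y s) y hy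
        (fun n hn => hagree y y hys (fun _ _ => rfl) n (hn.trans_le hle)) j hj]
  · intro x hxs
    have hle : a₁ ≤ max (max a₀ (b + 1)) (max a₁ a₂) := (le_max_left _ _).trans (le_max_right _ _)
    exact ha₁ _ (splice_mem_tailClass b x s) x
      (fun n hn => hagree x x hxs (fun _ _ => rfl) n (hn.trans_le hle))

/-! ### Summing errors and approximating weights by blocks -/

/-- Block i + 1 and, by induction, everything after it lie in F (i + 1), so their union lies in F i;
closedness of F i passes to the whole tail. -/
theorem mem_of_blocks_mem {J : Order.Ideal (Set ℕ)} {F : ℕ → Set (Set ℕ)}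
    (hF : ∀ i, IsLarge J (F i))
    (hdouble : ∀ i, ∀ x ∈ F (i + 1), ∀ y ∈ F (i + 1), x ∪ y ∈ F i)
    (hexh : ∀ x : Set ℕ, (∀ n ∈ x, {n} ∈ J) → (∀ i, ∃ n, x \ Set.Iio n ∈ F i) → x ∈ J)
    {k : ℕ → ℕ} (hk : StrictMono k) {x : Set ℕ} (hx : ∀ n ∈ x, {n} ∈ J)
    (hblock : ∀ i, x ∩ Set.Ico (k i) (k (i + 1)) ∈ F i) : x ∈ J := by
  refine hexh x hx fun i => ⟨k (i + 1), (hF i).closed _ fun E hE => ?_⟩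
  have key : ∀ l i, x ∩ Set.Ico (k (i + 1)) (k (i + 1 + l)) ∈ F i := by
    intro l
    induction l with
    | zero =>
      intro i
      exact (hF i).mono _ _ (hblock i) (by simp)
    | succ l ih =>
      intro i
      refine (hF i).mono _ _ (hdouble i _ (hblock (i + 1)) _ (ih (i + 1))) ?_
      rintro m ⟨hm, hm1, hm2⟩
      by_cases h : m < k (i + 1 + 1)
      · exact Or.inl ⟨hm, hm1, h⟩
      · refine Or.inr ⟨hm, not_lt.1 h, ?_⟩
        rwa [show i + 1 + 1 + l = i + 1 + (l + 1) by ring]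
  refine (hF i).mono _ _ (key (E.sup id + 1) i) fun m hm => ?_
  have h1 : m < E.sup id + 1 := Nat.lt_succ_of_le (Finset.le_sup (f := id) hm)
  have h2 : E.sup id + 1 ≤ k (i + 1 + (E.sup id + 1)) := le_trans (by omega) hk.le_apply
  exact ⟨(hE hm).1, Set.notMem_Iio.1 (hE hm).2, lt_of_lt_of_le h1 h2⟩

/-- Start where all terms are below ε and stop when the sum first reaches t: the overshoot is at
most the last term. -/
theorem exists_Ico_sum_approx {r : ℕ → ℝ} (hr0 : Tendsto r atTop (𝓝 0))
    (hsum : Tendsto (fun N => ∑ n ∈ Finset.range N, r n) atTop atTop) (a : ℕ) {t ε : ℝ}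
    (ht : 0 ≤ t) (hε : 0 < ε) :
    ∃ N M, a ≤ N ∧ N ≤ M ∧ |∑ n ∈ Finset.Ico N M, r n - t| ≤ ε := by
  obtain ⟨N₀, hN₀⟩ := eventually_atTop.1 (hr0.eventually (gt_mem_nhds hε))
  set N := max a N₀
  have hex : ∃ d, t ≤ ∑ n ∈ Finset.Ico N (N + d), r n := by
    obtain ⟨M, hM, hNM⟩ := ((hsum.eventually_ge_atTop
      (t + ∑ n ∈ Finset.range N, r n)).and (eventually_ge_atTop N)).exists
    refine ⟨M - N, ?_⟩
    rw [Nat.add_sub_cancel' hNM, Finset.sum_Ico_eq_sub _ hNM]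
    linarith
  refine ⟨N, N + Nat.find hex, le_max_left _ _, Nat.le_add_right _ _, ?_⟩
  have h1 := Nat.find_spec hex
  rw [abs_of_nonneg (by linarith)]
  rcases h : Nat.find hex with _ | d
  · simp only [add_zero, Finset.Ico_self, Finset.sum_empty]
    linarith
  · have h2 := Nat.find_min hex (m := d) (by omega)
    rw [← add_assoc, Finset.sum_Ico_succ_top (Nat.le_add_right _ _)]
    have h3 := hN₀ (N + d) ((le_max_right _ _).trans (Nat.le_add_right _ _))
    linarith

theorem summable_iff_of_sum_range {p q : ℕ → ℝ} (hp : ∀ n, 0 ≤ p n) (hq : ∀ n, 0 ≤ q n)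
    {b : ℕ → ℕ} (hb : StrictMono b)
    (h : ∀ N, ∑ n ∈ Finset.range (b N), p n = ∑ i ∈ Finset.range N, q i) :
    Summable p ↔ Summable q := by
  constructor
  · intro hs
    refine summable_of_sum_range_le hq (c := ∑' n, p n) fun N => ?_
    rw [← h]
    exact hs.sum_le_tsum _ fun n _ => hp n
  · intro hs
    refine summable_of_sum_range_le hp (c := ∑' n, q n) fun N => ?_
    refine le_trans ?_ (hs.sum_le_tsum (Finset.range N) fun n _ => hq n)
    rw [← h]
    exact Finset.sum_le_sum_of_subset_of_nonneg
      (Finset.range_subset_range.2 hb.le_apply) fun n _ _ => hp n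

theorem mem_summableIdeal_of_finite {r : ℕ → ℝ} {hr : ∀ n, 0 ≤ r n} {x : Set ℕ} (hx : x.Finite) :
    x ∈ summableIdeal r hr := by
  have := hx.to_subtype
  exact summable_of_hasFiniteSupport (Set.toFinite _)

theorem biUnion_mem_summableIdeal_iff {r : ℕ → ℝ} (hr : ∀ n, 0 ≤ r n) {b : ℕ → ℕ}
    (hb : StrictMono b) (hb0 : b 0 = 0) {u : ℕ → Finset ℕ}
    (hu : ∀ i, u i ⊆ Finset.Ico (b i) (b (i + 1))) {ε : ℕ → ℝ} (hε : Summable ε)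
    (happ : ∀ i, |∑ n ∈ u i, r n - r i| ≤ ε i) (x : Set ℕ) :
    (⋃ i ∈ x, (u i : Set ℕ)) ∈ summableIdeal r hr ↔ x ∈ summableIdeal r hr := by
  classical
  have hmem : ∀ y : Set ℕ, y ∈ summableIdeal r hr ↔ Summable (y.indicator r) := fun y =>
    summable_subtype_iff_indicator
  have hblock : ∀ i, ∀ n ∈ Finset.Ico (b i) (b (i + 1)),
      (n ∈ ⋃ i ∈ x, (u i : Set ℕ)) ↔ i ∈ x ∧ n ∈ u i := by
    intro i n hn
    simp only [Set.mem_iUnion, Finset.mem_coe, exists_prop]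
    refine ⟨?_, fun h => ⟨i, h⟩⟩
    rintro ⟨j, hj, hnj⟩
    have h1 := Finset.mem_Ico.1 (hu j hnj)
    have h2 := Finset.mem_Ico.1 hn
    have h3 : j < i + 1 := hb.lt_iff_lt.1 (h1.1.trans_lt h2.2)
    have h4 : i < j + 1 := hb.lt_iff_lt.1 (h2.1.trans_lt h1.2)
    obtain rfl : j = i := by omega
    exact ⟨hj, hnj⟩
  rw [hmem, hmem, summable_iff_of_sum_range (q := x.indicator fun i => ∑ n ∈ u i, r n)
    (fun n => Set.indicator_nonneg (fun n _ => hr n) n)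
    (fun n => Set.indicator_nonneg (fun n _ => Finset.sum_nonneg fun m _ => hr m) n) hb]
  · have hdiff : Summable (x.indicator fun i => ∑ n ∈ u i, r n - r i) :=
      Summable.of_norm_bounded hε fun i => by
        by_cases hi : i ∈ x
        · simpa [hi] using happ i
        · simpa [hi] using (abs_nonneg _).trans (happ i)
    have heq : (x.indicator fun i => ∑ n ∈ u i, r n) =
        fun i => x.indicator (fun i => ∑ n ∈ u i, r n - r i) i + x.indicator r i := by
      ext i
      by_cases hi : i ∈ x <;> simp [hi]
    rw [heq]
    exact ⟨fun h => by simpa using h.sub hdiff, fun h => hdiff.add h⟩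
  · intro N
    induction N with
    | zero => simp [hb0]
    | succ N ih =>
      rw [Finset.sum_range_succ, ← ih,
        ← Finset.sum_range_add_sum_Ico _ (hb.monotone (Nat.le_succ N))]
      congr 1
      by_cases hN : N ∈ x
      · rw [Set.indicator_of_mem hN, ← Finset.sum_subset (hu N)]
        · refine Finset.sum_congr rfl fun n hn => ?_
          exact Set.indicator_of_mem ((hblock N n (hu N hn)).2 ⟨hN, hn⟩) _
        · intro n hn hnu
          exact Set.indicator_of_notMem (fun h => hnu ((hblock N n hn).1 h).2) _
      · rw [Set.indicator_of_notMem hN]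
        refine Finset.sum_eq_zero fun n hn => ?_
        exact Set.indicator_of_notMem (fun h => hN ((hblock N n hn).1 h).1) _

theorem mem_ideal_iff_of_symmDiff {J : Order.Ideal (Set ℕ)} {A B : Set ℕ}
    (h : symmDiff A B ∈ J) : A ∈ J ↔ B ∈ J := by
  constructor
  · intro hA
    refine ideal_subset_mem (ideal_union_mem hA h) fun n hn => ?_
    by_cases hnA : n ∈ A
    · exact Or.inl hnA
    · exact Or.inr (Set.mem_symmDiff.2 (Or.inr ⟨hn, hnA⟩))
  · intro hB
    refine ideal_subset_mem (ideal_union_mem hB h) fun n hn => ?_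
    by_cases hnB : n ∈ B
    · exact Or.inl hnB
    · exact Or.inr (Set.mem_symmDiff.2 (Or.inl ⟨hn, hnB⟩))

/-! ### From a Borel reduction to a block reduction -/

/-- The point with the strings `s i` on `[b i, a i)` and with the blocks `u i`, `i ∈ x`. -/
noncomputable def interleave (b a : ℕ → ℕ) (s : ℕ → ℕ → Bool) (u : ℕ → Finset ℕ) (x : Set ℕ) :
    ℕ → Bool := by
  classical
  exact fun n => decide ((∃ i, b i ≤ n ∧ n < a i ∧ s i n = true) ∨ ∃ i ∈ x, n ∈ u i)

section Interleave

variable {b a : ℕ → ℕ} {s : ℕ → ℕ → Bool} {u : ℕ → Finset ℕ}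

theorem interleave_of_mem (hb : StrictMono b) (ha : ∀ i, a i ≤ b (i + 1)) (hba : ∀ i, b i < a i)
    (hu : ∀ i, u i ⊆ Finset.Ico (a i) (b (i + 1))) (x : Set ℕ) {i n : ℕ} (h1 : b i ≤ n)
    (h2 : n < a i) : interleave b a s u x n = s i n := by
  have hi : ∀ j, b j ≤ n → n < b (j + 1) → j = i := by
    intro j h3 h4
    have h5 : j < i + 1 := hb.lt_iff_lt.1 (h3.trans_lt (h2.trans_le (ha i)))
    have h6 : i < j + 1 := hb.lt_iff_lt.1 (h1.trans_lt h4)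
    omega
  rw [Bool.eq_iff_iff]
  simp only [interleave, decide_eq_true_eq]
  constructor
  · rintro (⟨j, h3, h4, h5⟩ | ⟨j, -, h3⟩)
    · rwa [hi j h3 (h4.trans_le (ha j))] at h5
    · exfalso
      obtain ⟨h4, h5⟩ := Finset.mem_Ico.1 (hu j h3)
      rw [hi j ((hba j).le.trans h4) h5] at h4
      omega
  · intro h
    exact Or.inl ⟨i, h1, h2, h⟩

theorem exists_of_interleave_ne {x y : Set ℕ} {n : ℕ}
    (h : interleave b a s u x n ≠ interleave b a s u y n) :
    ∃ i, n ∈ u i ∧ ¬ (i ∈ x ↔ i ∈ y) := by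
  by_contra hc
  simp only [not_exists, not_and, not_not] at hc
  refine h ?_
  simp only [interleave]
  congr 1
  rw [eq_iff_iff]
  refine or_congr Iff.rfl (exists_congr fun i => ?_)
  constructor
  · exact fun hx => ⟨(hc i hx.2).1 hx.1, hx.2⟩
  · exact fun hx => ⟨(hc i hx.2).2 hx.1, hx.2⟩

theorem interleave_ne_iff (hb : StrictMono b) (ha : ∀ i, a i ≤ b (i + 1)) (hba : ∀ i, b i < a i)
    (hu : ∀ i, u i ⊆ Finset.Ico (a i) (b (i + 1))) (x : Set ℕ) (n : ℕ) :
    interleave b a s u x n ≠ interleave b a s u ∅ n ↔ n ∈ ⋃ i ∈ x, (u i : Set ℕ) := by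
  simp only [Set.mem_iUnion, Finset.mem_coe, exists_prop]
  constructor
  · intro h
    obtain ⟨i, hi, hix⟩ := exists_of_interleave_ne h
    exact ⟨i, by simpa using hix, hi⟩
  · rintro ⟨i, hi, hn⟩
    have h1 : interleave b a s u x n = true := by
      simp only [interleave, decide_eq_true_eq]
      exact Or.inr ⟨i, hi, hn⟩
    have h2 : ¬ interleave b a s u ∅ n = true := by
      simp only [interleave, decide_eq_true_eq]
      rintro (⟨j, h3, h4, -⟩ | ⟨j, h3, -⟩)
      · obtain ⟨h5, h6⟩ := Finset.mem_Ico.1 (hu i hn)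
        have h7 : j < i + 1 := hb.lt_iff_lt.1 (h3.trans_lt h6)
        have h8 : i < j + 1 := hb.lt_iff_lt.1 ((hba i).trans_le
          (h5.trans (h4.le.trans (ha j))))
        obtain rfl : j = i := by omega
        omega
      · exact h3
    rw [h1]
    exact fun h => h2 h.symm

end Interleave

/-- On [k i, k (i + 1)) the value θ (z x) depends only on x ∩ [0, i], and up to an error in F i only
on whether i ∈ x. The prescribed growth g is met by handing g (k i) to the next stage as the lower
bound for k (i + 1). -/
theorem exists_block_reduction {r : ℕ → ℝ} {hr : ∀ n, 0 ≤ r n} (hr0 : Tendsto r atTop (𝓝 0))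
    (hsum : Tendsto (fun N => ∑ n ∈ Finset.range N, r n) atTop atTop)
    {J : Order.Ideal (Set ℕ)} (hJ : IsBorelIdeal J) (hP : IsPIdeal J)
    (hred : IdealBorelReducible (summableIdeal r hr) J) (g : ℕ → ℕ) (hg : ∀ k, k < g k) :
    ∃ (w : ℕ → Finset ℕ) (k : ℕ → ℕ), (∀ i, w i ⊆ Finset.Ico (k i) (k (i + 1))) ∧
      (∀ i, g (k i) ≤ k (i + 1)) ∧
      ∀ x : Set ℕ, x ∈ summableIdeal r hr ↔ (⋃ i ∈ x, (w i : Set ℕ)) ∈ J := by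
  classical
  obtain ⟨F, hF, hdouble, hexh⟩ := hP.exists_exhaustion hJ
  obtain ⟨ϑ, hϑ, hϑJ⟩ := hred
  set θ : (ℕ → Bool) → Set ℕ := fun x => ϑ {n | x n = true} with hθdef
  have hθm : Measurable θ := hϑ.comp (measurable_set_iff.2 fun n => measurableSet_setOfPred.1 (by
      exact measurableSet_eq_fun (measurable_pi_apply n) measurable_const))
  have hθ : ∀ x y : ℕ → Bool, {n | x n ≠ y n} ∈ summableIdeal r hr ↔
      symmDiff (θ x) (θ y) ∈ J := by
    intro x y
    have h := hϑJ {n | x n = true} {n | y n = true}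
    unfold idealRel at h
    rw [← h]
    have : {n | x n ≠ y n} = symmDiff {n | x n = true} {n | y n = true} := by
      ext n
      simp only [Set.mem_symmDiff, Set.mem_ofPred_eq]
      cases x n <;> cases y n <;> simp
    rw [this]
  have hfin : ∀ x y : ℕ → Bool, {n | x n ≠ y n}.Finite → symmDiff (θ x) (θ y) ∈ J :=
    fun x y h => (hθ x y).1 (mem_summableIdeal_of_finite h)
  obtain ⟨C, hG, hd, hinv, hcont⟩ := hθm.exists_invariant_continuousOn
  obtain ⟨O, hO, hCO⟩ := hG.eq_iInter_nat
  have hstage : ∀ (i : ℕ) (p : ℕ × ℕ), ∃ k a b' : ℕ, ∃ s : ℕ → Bool, ∃ u : Finset ℕ,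
      p.2 ≤ k ∧ p.1 < a ∧ a ≤ b' ∧ u ⊆ Finset.Ico a b' ∧ |∑ n ∈ u, r n - r i| ≤ (1 / 2) ^ i ∧
      (∀ x ∈ C, (∀ n, p.1 ≤ n → n < a → x n = s n) →
        tailVariation θ p.1 x \ Set.Iio k ∈ F i) ∧
      (∀ x ∈ C, ∀ y ∈ C, (∀ n, p.1 ≤ n → n < a → x n = s n) →
        (∀ n, p.1 ≤ n → n < a → y n = s n) →
        (∀ n < p.1, x n = y n) → ∀ j < k, (j ∈ θ x ↔ j ∈ θ y)) ∧
      (∀ x, (∀ n, p.1 ≤ n → n < a → x n = s n) → x ∈ O i) := by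
    rintro i ⟨b, K⟩
    obtain ⟨k, a, s, h1, h2, h3, h4, h5⟩ := exists_stabilizer hfin hG hd hinv hcont (hF i) (hO i)
      (hCO.le.trans (Set.iInter_subset _ _)) b K
    obtain ⟨N, M, h6, h7, h8⟩ := exists_Ico_sum_approx hr0 hsum a (hr i)
      (show (0 : ℝ) < (1 / 2) ^ i by positivity)
    exact ⟨k, a, M, s, Finset.Ico N M, h1, h2, h6.trans h7,
      Finset.Ico_subset_Ico_left h6, h8, h3, h4, h5⟩
  choose fk fa fb fs fu q1 q2 q3 q4 q5 q6 q7 q8 using hstage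
  let S : ℕ → ℕ × ℕ := fun n => Nat.rec (0, 0) (fun i p => (fb i p, g (fk i p))) n
  let b : ℕ → ℕ := fun i => (S i).1
  let k : ℕ → ℕ := fun i => fk i (S i)
  let a : ℕ → ℕ := fun i => fa i (S i)
  let s : ℕ → ℕ → Bool := fun i => fs i (S i)
  let u : ℕ → Finset ℕ := fun i => fu i (S i)
  have hba : ∀ i, b i < a i := fun i => q2 i (S i)
  have hab : ∀ i, a i ≤ b (i + 1) := fun i => q3 i (S i)
  have hb : StrictMono b := strictMono_nat_of_lt_succ fun i => (hba i).trans_le (hab i)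
  have hgk : ∀ i, g (k i) ≤ k (i + 1) := fun i => q1 (i + 1) (S (i + 1))
  have hk : StrictMono k := strictMono_nat_of_lt_succ fun i => (hg _).trans_le (hgk i)
  have hu : ∀ i, u i ⊆ Finset.Ico (a i) (b (i + 1)) := fun i => q4 i (S i)
  set z : Set ℕ → ℕ → Bool := interleave b a s u with hz
  have hzs : ∀ x i n, b i ≤ n → n < a i → z x n = s i n := fun x i n =>
    interleave_of_mem hb hab hba hu x
  -- The i-th string alone forces membership in O i, so all of them force membership in C.
  have hzC : ∀ x, z x ∈ C := by
    intro x
    rw [hCO]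
    exact Set.mem_iInter.2 fun i => q8 i (S i) _ (hzs x i)
  have hvar : ∀ x i, tailVariation θ (b i) (z x) \ Set.Iio (k i) ∈ F i := fun x i =>
    q6 i (S i) _ (hzC x) (hzs x i)
  have hdet : ∀ x y i, (∀ n < b i, z x n = z y n) → ∀ j < k i, (j ∈ θ (z x) ↔ j ∈ θ (z y)) :=
    fun x y i h => q7 i (S i) _ (hzC x) _ (hzC y) (hzs x i) (hzs y i) h
  have hlow : ∀ x y : Set ℕ, ∀ i, (∀ j < i, (j ∈ x ↔ j ∈ y)) → ∀ n < b i, z x n = z y n := by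
    intro x y i h n hn
    by_contra hne
    obtain ⟨j, hj, hxy⟩ := exists_of_interleave_ne hne
    refine hxy (h j ?_)
    exact hb.lt_iff_lt.1 ((hba j).trans_le ((Finset.mem_Ico.1 (hu j hj)).1.trans hn.le))
  have hhigh : ∀ x y : Set ℕ, ∀ i, (∀ j, i ≤ j → (j ∈ x ↔ j ∈ y)) →
      z x ∈ tailClass (b i) (z y) := by
    intro x y i h n hn
    by_contra hne
    obtain ⟨j, hj, hxy⟩ := exists_of_interleave_ne hne
    refine hxy (h j ?_)
    exact Nat.lt_succ_iff.1 (hb.lt_iff_lt.1 (hn.trans_lt (Finset.mem_Ico.1 (hu j hj)).2))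
  let w : ℕ → Finset ℕ := fun i =>
    (Finset.Ico (k i) (k (i + 1))).filter (· ∈ symmDiff (θ (z {i})) (θ (z ∅)))
  have hw : ∀ i, w i ⊆ Finset.Ico (k i) (k (i + 1)) := fun i => Finset.filter_subset _ _
  refine ⟨w, k, hw, hgk, fun x => ?_⟩
  have hεsum : Summable fun i : ℕ => ((1 : ℝ) / 2) ^ i := summable_geometric_two
  rw [← biUnion_mem_summableIdeal_iff hr hb rfl
    (fun i => (hu i).trans (Finset.Ico_subset_Ico_left (hba i).le)) hεsum
    (fun i => q5 i (S i)) x]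
  have hset : (⋃ i ∈ x, (u i : Set ℕ)) = {n | z x n ≠ z ∅ n} := by
    ext n
    exact (interleave_ne_iff hb hab hba hu x n).symm
  rw [hset, hθ]
  refine mem_ideal_iff_of_symmDiff ?_
  set e := symmDiff (symmDiff (θ (z x)) (θ (z ∅))) (⋃ i ∈ x, (w i : Set ℕ)) with he
  have hwblock : ∀ i j, k i ≤ j → j < k (i + 1) →
      (j ∈ (⋃ i ∈ x, (w i : Set ℕ)) ↔ i ∈ x ∧ j ∈ symmDiff (θ (z {i})) (θ (z ∅))) := by
    intro i j h1 h2
    simp only [Set.mem_iUnion, Finset.mem_coe, exists_prop]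
    constructor
    · rintro ⟨l, hl, hjl⟩
      obtain ⟨h3, h4⟩ := Finset.mem_Ico.1 (hw l hjl)
      have h5 : l < i + 1 := hk.lt_iff_lt.1 (h3.trans_lt h2)
      have h6 : i < l + 1 := hk.lt_iff_lt.1 (h1.trans_lt h4)
      obtain rfl : l = i := by omega
      exact ⟨hl, (Finset.mem_filter.1 hjl).2⟩
    · rintro ⟨hi, hj⟩
      exact ⟨i, hi, Finset.mem_filter.2 ⟨Finset.mem_Ico.2 ⟨h1, h2⟩, hj⟩⟩
  have hsub : ∀ i, e ∩ Set.Ico (k i) (k (i + 1)) ⊆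
      tailVariation θ (b i) (z (x ∩ {i})) \ Set.Iio (k i) := by
    rintro i j ⟨hje, hj1, hj2⟩
    refine ⟨?_, Set.notMem_Iio.2 hj1⟩
    -- Below k (i + 1) blocks after i are invisible, by the stabilizer of stage i + 1; dropping
    -- blocks before i then costs only the variation at b i.
    have h1 : j ∈ θ (z x) ↔ j ∈ θ (z (x ∩ Set.Iic i)) :=
      hdet _ _ (i + 1) (hlow x (x ∩ Set.Iic i) (i + 1) fun l hl => by
        simp only [Set.mem_inter_iff, Set.mem_Iic]
        exact ⟨fun h => ⟨h, Nat.lt_succ_iff.1 hl⟩, fun h => h.1⟩) j hj2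
    have h2 : j ∈ symmDiff (θ (z (x ∩ Set.Iic i))) (θ (z (x ∩ {i}))) := by
      rw [he, Set.mem_symmDiff, hwblock i j hj1 hj2, Set.mem_symmDiff, Set.mem_symmDiff, h1] at hje
      rw [Set.mem_symmDiff]
      by_cases hi : i ∈ x
      · have : x ∩ {i} = {i} := Set.inter_eq_right.2 (Set.singleton_subset_iff.2 hi)
        rw [this]
        tauto
      · have : x ∩ {i} = ∅ := Set.inter_singleton_eq_empty.2 hi
        rw [this]
        tauto
    simp only [tailVariation, Set.mem_iUnion]
    refine ⟨_, hhigh (x ∩ Set.Iic i) (x ∩ {i}) i fun l hl => ?_, _, fun _ _ => rfl, h2⟩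
    simp only [Set.mem_inter_iff, Set.mem_Iic, Set.mem_singleton_iff]
    refine and_congr Iff.rfl ⟨fun h => ?_, fun h => h.le⟩
    omega
  have hcover : ∀ j ∈ e, ∃ i, j ∈ Set.Ico (k i) (k (i + 1)) := by
    intro j hj
    -- Since b 0 = 0, the agreement required at stage 0 is vacuous, and θ ∘ z is constant below k 0.
    have hj0 : ¬ j < k 0 := by
      intro hlt
      have h1 : j ∈ θ (z x) ↔ j ∈ θ (z ∅) := hdet _ _ 0 (fun n hn => absurd hn (Nat.not_lt_zero n))
        j hlt
      have h2 : j ∉ ⋃ i ∈ x, (w i : Set ℕ) := by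
        simp only [Set.mem_iUnion, Finset.mem_coe, exists_prop, not_exists, not_and]
        intro i _ hji
        have h3 := (Finset.mem_Ico.1 (hw i hji)).1
        have h4 := hk.monotone (Nat.zero_le i)
        omega
      rw [he, Set.mem_symmDiff, Set.mem_symmDiff, h1] at hj
      tauto
    exact hk.exists_mem_Ico (not_lt.1 hj0)
  refine mem_of_blocks_mem hF hdouble hexh hk (fun j hj => ?_) fun i =>
    (hF i).mono _ _ (hvar _ i) (hsub i)
  obtain ⟨i, hi⟩ := hcover j hj
  exact ideal_subset_mem (tailVariation_mem hfin (b i) (z (x ∩ {i})))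
    (Set.singleton_subset_iff.2 (hsub i ⟨hj, hi⟩).1)

/-! ### Nonempty blocks and exponential growth -/

theorem Set.Infinite.exists_infinite_subset_mem_summableIdeal {r : ℕ → ℝ} (hr : ∀ n, 0 ≤ r n)
    (hr0 : Tendsto r atTop (𝓝 0)) {T : Set ℕ} (hT : T.Infinite) :
    ∃ y ⊆ T, y.Infinite ∧ y ∈ summableIdeal r hr := by
  obtain ⟨φ, hφ, hφT⟩ := extraction_forall_of_frequently
    (P := fun n m => m ∈ T ∧ r m ≤ (1 / 2 : ℝ) ^ n) fun n =>
      (Nat.frequently_atTop_iff_infinite.2 hT).and_eventually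
        (hr0.eventually (ge_mem_nhds (by positivity)))
  refine ⟨Set.range φ, ?_, Set.infinite_range_of_injective hφ.injective, ?_⟩
  · rintro _ ⟨n, rfl⟩
    exact (hφT n).1
  · have h : Summable fun n => r (φ n) :=
      Summable.of_nonneg_of_le (fun n => hr _) (fun n => (hφT n).2) summable_geometric_two
    exact (Equiv.ofInjective φ hφ.injective).summable_iff.1 h

theorem univ_notMem_summableIdeal {r : ℕ → ℝ} {hr : ∀ n, 0 ≤ r n}
    (hsum : Tendsto (fun N => ∑ n ∈ Finset.range N, r n) atTop atTop) :
    Set.univ ∉ summableIdeal r hr := by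
  intro h
  have h1 : Summable (Set.univ.indicator r) := summable_subtype_iff_indicator.1 h
  rw [Set.indicator_univ] at h1
  exact not_tendsto_nhds_of_tendsto_atTop hsum _ h1.tendsto_sum_tsum_nat

/-- Farah's theorem: Borel reductions of a summable ideal to a Borel P-ideal can be replaced by
exponential Rudin–Blass reductions. -/
theorem IsPIdeal.rbppExponentially {r : ℕ → ℝ} {hr : ∀ n, 0 ≤ r n} (hr0 : Tendsto r atTop (𝓝 0))
    (hsum : Tendsto (fun N => ∑ n ∈ Finset.range N, r n) atTop atTop)
    {J : Order.Ideal (Set ℕ)} (hJ : IsBorelIdeal J) (hP : IsPIdeal J)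
    (hred : IdealBorelReducible (summableIdeal r hr) J) :
    RBppExponentially (summableIdeal r hr) J := by
  classical
  -- The blocks w i may be empty. A first reduction provides an infinite Q ∈ J, and one point of Q
  -- added to each block of a second reduction makes it nonempty while changing unions only inside
  -- Q.
  obtain ⟨Q, hQJ, hQ⟩ : ∃ Q ∈ J, Q.Infinite := by
    obtain ⟨w, k, hw, hk, hmem⟩ := exists_block_reduction hr0 hsum hJ hP hred (fun k => k + 1)
      Nat.lt_succ_self
    have hkm : StrictMono k := strictMono_nat_of_lt_succ hk
    have hT : {i | (w i).Nonempty}.Infinite := by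
      intro hfin
      refine univ_notMem_summableIdeal (hr := hr) hsum ?_
      have h1 : {i | (w i).Nonempty}ᶜ ∈ summableIdeal r hr := by
        rw [hmem]
        convert J.bot_mem using 1
        refine Set.eq_empty_of_forall_notMem fun n hn => ?_
        simp only [Set.mem_iUnion, exists_prop] at hn
        obtain ⟨i, hi, hni⟩ := hn
        exact hi ⟨n, hni⟩
      rw [← Set.union_compl_self {i | (w i).Nonempty}]
      exact ideal_union_mem (mem_summableIdeal_of_finite hfin) h1
    obtain ⟨y, hyT, hy, hyI⟩ := hT.exists_infinite_subset_mem_summableIdeal hr hr0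
    refine ⟨_, (hmem y).1 hyI, Set.infinite_of_forall_exists_gt fun B => ?_⟩
    obtain ⟨i, hi, hBi⟩ := hy.exists_gt B
    obtain ⟨n, hn⟩ := hyT hi
    refine ⟨n, Set.mem_biUnion hi hn, ?_⟩
    exact hBi.trans_le (hkm.le_apply.trans (Finset.mem_Ico.1 (hw i hn)).1)
  choose q hqQ hq using fun k => hQ.exists_gt k
  -- This growth yields doubling and leaves room for the point q (k i) in the i-th interval.
  obtain ⟨w, k, hw, hk, hmem⟩ := exists_block_reduction hr0 hsum hJ hP hred
    (fun k => max (2 * k) (q k) + 1) fun k => Nat.lt_succ_of_le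
      ((hq k).le.trans (le_max_right _ _))
  have hk1 : ∀ i, 2 * k i ≤ k (i + 1) := fun i =>
    (le_max_left _ _).trans ((Nat.le_succ _).trans (hk i))
  have hk2 : ∀ i, q (k i) < k (i + 1) := fun i =>
    lt_of_lt_of_le (Nat.lt_succ_of_le (le_max_right _ _)) (hk i)
  have hkm : StrictMono k := strictMono_nat_of_lt_succ fun i => (hq (k i)).trans (hk2 i)
  have hsub : ∀ i, insert (q (k i)) (w i) ⊆ Finset.Ico (k i) (k (i + 1)) := fun i =>
    Finset.insert_subset (Finset.mem_Ico.2 ⟨(hq _).le, hk2 i⟩) (hw i)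
  refine ⟨fun i => insert (q (k i)) (w i), ⟨fun i => Finset.insert_nonempty _ _, ?_, ?_, ?_⟩,
    k, hsub, hk1⟩
  · intro i j hij
    refine Disjoint.mono (hsub i) (hsub j) (Finset.disjoint_left.2 fun n hi hj => hij ?_)
    obtain ⟨h1, h2⟩ := Finset.mem_Ico.1 hi
    obtain ⟨h3, h4⟩ := Finset.mem_Ico.1 hj
    have h5 : i < j + 1 := hkm.lt_iff_lt.1 (h1.trans_lt h4)
    have h6 : j < i + 1 := hkm.lt_iff_lt.1 (h3.trans_lt h2)
    omega
  · intro i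
    exact (Finset.mem_Ico.1 (hsub i (Finset.max'_mem _ _))).2.trans_le
      (Finset.mem_Ico.1 (hsub (i + 1) (Finset.min'_mem _ _))).1
  · intro x
    rw [hmem]
    refine mem_ideal_iff_of_symmDiff (ideal_subset_mem hQJ fun n hn => ?_)
    rw [Set.mem_symmDiff] at hn
    simp only [Set.mem_iUnion, Finset.mem_coe, exists_prop, Finset.mem_insert] at hn
    rcases hn with ⟨⟨i, hi, h⟩, hn⟩ | ⟨⟨i, hi, rfl | h⟩, hn⟩
    · exact absurd ⟨i, hi, Or.inr h⟩ hn
    · exact hqQ _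
    · exact absurd ⟨i, hi, h⟩ hn

/-! ### The density ideal -/

theorem mem_densityIdeal {x : Set ℕ} : x ∈ densityIdeal ↔
    Tendsto (fun n : ℕ => ((x ∩ Set.Iio n).ncard : ℝ) / n) atTop (𝓝 0) :=
  Iff.rfl

theorem ncard_inter_Iio_mono {x y : Set ℕ} {n : ℕ} (h : x ∩ Set.Iio n ⊆ y) :
    (x ∩ Set.Iio n).ncard ≤ (y ∩ Set.Iio n).ncard :=
  Set.ncard_le_ncard (Set.subset_inter h Set.inter_subset_right)
    ((Set.finite_Iio n).subset Set.inter_subset_right)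

theorem mem_densityIdeal_iff {x : Set ℕ} : x ∈ densityIdeal ↔
    ∀ ε : ℝ, 0 < ε → ∃ N, ∀ n ≥ N, ((x ∩ Set.Iio n).ncard : ℝ) ≤ ε * n := by
  rw [mem_densityIdeal]
  constructor
  · intro h ε hε
    obtain ⟨N, hN⟩ := eventually_atTop.1 (h.eventually (gt_mem_nhds hε))
    refine ⟨N + 1, fun n hn => ?_⟩
    have hn0 : (0 : ℝ) < n := by exact_mod_cast (Nat.succ_pos N).trans_le hn
    exact ((div_lt_iff₀ hn0).1 (hN n (by omega))).le
  · intro h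
    refine tendsto_order.2 ⟨fun c hc => Eventually.of_forall fun n => hc.trans_le (by positivity),
      fun ε hε => ?_⟩
    obtain ⟨N, hN⟩ := h (ε / 2) (by positivity)
    filter_upwards [eventually_ge_atTop (N + 1)] with n hn
    have hn0 : (0 : ℝ) < n := by exact_mod_cast (Nat.succ_pos N).trans_le hn
    rw [div_lt_iff₀ hn0]
    have := hN n (by omega)
    nlinarith

theorem isBorelIdeal_densityIdeal : IsBorelIdeal densityIdeal := by
  classical
  have hm : ∀ n : ℕ, Measurable fun x : Set ℕ => ((x ∩ Set.Iio n).ncard : ℝ) / n := by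
    intro n
    have : (fun x : Set ℕ => ((x ∩ Set.Iio n).ncard : ℝ) / n) =
        fun x => (∑ j ∈ Finset.range n, if j ∈ x then (1 : ℝ) else 0) / n := by
      ext x
      have hx : x ∩ Set.Iio n = ((Finset.range n).filter (· ∈ x) : Finset ℕ) := by
        ext j
        simp [and_comm]
      rw [hx, Set.ncard_coe_finset, Finset.sum_boole]
    rw [this]
    refine Measurable.div_const (Finset.measurable_fun_sum _ fun j _ => ?_) _
    exact Measurable.ite (measurableSet_setOfPred.2 (measurable_set_mem j)) measurable_const
      measurable_const
  exact measurableSet_tendsto (𝓝 (0 : ℝ)) hm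

/-- The pseudo-union follows the increasing finite unions X i on intervals [m i, m (i + 1)) that
start, for i ≥ 1, after X i has density at most 1 / (i + 1); below n in that interval it is
contained in X i. -/
theorem isPIdeal_densityIdeal : IsPIdeal densityIdeal := by
  intro x hx
  let X : ℕ → Set ℕ := fun n => ⋃ i ∈ Set.Iic n, x i
  have hX : ∀ n, X n ∈ densityIdeal := fun n =>
    ideal_biUnion_mem (Set.finite_Iic n) fun i _ => hx i
  choose N hN using fun n => mem_densityIdeal_iff.1 (hX n) (1 / ((n : ℝ) + 1)) (by positivity)
  let m : ℕ → ℕ := fun n => Nat.rec 0 (fun i p => max (p + 1) (N (i + 1))) n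
  have hm : StrictMono m := strictMono_nat_of_lt_succ fun i =>
    (Nat.lt_succ_self _).trans_le (le_max_left _ _)
  have hmN : ∀ i, N (i + 1) ≤ m (i + 1) := fun i => le_max_right _ _
  have hXmono : ∀ i j, i ≤ j → X i ⊆ X j := fun i j hij =>
    Set.biUnion_subset_biUnion_left (Set.Iic_subset_Iic.2 hij)
  refine ⟨{n | ∃ i, m i ≤ n ∧ n < m (i + 1) ∧ n ∈ X i}, ?_, fun j => ?_⟩
  · rw [mem_densityIdeal_iff]
    intro ε hε
    obtain ⟨i₀, hi₀⟩ := exists_nat_one_div_lt hε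
    refine ⟨m (i₀ + 1), fun n hn => ?_⟩
    obtain ⟨i, hi1, hi2⟩ := hm.exists_mem_Ico (Nat.zero_le n)
    have hii : i₀ < i := by
      have : i₀ + 1 < i + 1 := hm.lt_iff_lt.1 (hn.trans_lt hi2)
      omega
    have h1 := hN i n (by
      obtain ⟨l, rfl⟩ := Nat.exists_eq_succ_of_ne_zero (by omega : i ≠ 0)
      exact (hmN l).trans hi1)
    have h2 : ((({n | ∃ i, m i ≤ n ∧ n < m (i + 1) ∧ n ∈ X i} : Set ℕ) ∩ Set.Iio n).ncard : ℝ) ≤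
        ((X i ∩ Set.Iio n).ncard : ℝ) := by
      have := ncard_inter_Iio_mono (x := {n | ∃ i, m i ≤ n ∧ n < m (i + 1) ∧ n ∈ X i}) (y := X i)
        (n := n) (by
          rintro l ⟨⟨j, hj1, hj2, hj3⟩, hl⟩
          refine hXmono j i ?_ hj3
          have : j < i + 1 := hm.lt_iff_lt.1 (hj1.trans_lt ((Set.mem_Iio.1 hl).trans hi2))
          omega)
      exact_mod_cast this
    have h3 : 1 / ((i : ℝ) + 1) ≤ ε := by
      refine le_trans ?_ hi₀.le
      apply one_div_le_one_div_of_le (by positivity)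
      have : (i₀ : ℝ) ≤ i := by exact_mod_cast hii.le
      linarith
    exact h2.trans (h1.trans (mul_le_mul_of_nonneg_right h3 (Nat.cast_nonneg n)))
  · refine (Set.finite_Iio (m j)).subset fun n hnxy => ?_
    obtain ⟨hnx, hn⟩ := hnxy
    refine Classical.by_contradiction fun hnm => ?_
    obtain ⟨i, h2, h1⟩ := hm.exists_mem_Ico (Nat.zero_le n)
    have h3 : j < i + 1 := hm.lt_iff_lt.1 ((Set.notMem_Iio.1 hnm).trans_lt h1)
    exact hn ⟨i, h2, h1, Set.mem_biUnion (Set.mem_Iic.2 (Nat.lt_succ_iff.1 h3)) hnx⟩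

theorem not_rbppExponentially_densityIdeal {r : ℕ → ℝ} {hr : ∀ n, 0 ≤ r n}
    (hr0 : Tendsto r atTop (𝓝 0))
    (hsum : Tendsto (fun N => ∑ n ∈ Finset.range N, r n) atTop atTop) :
    ¬ RBppExponentially (summableIdeal r hr) densityIdeal := by
  rintro ⟨w, hw, k, hwk, hk⟩
  -- Doubling alone allows k to stay at 0; nonempty blocks exclude this.
  have hkm : StrictMono k := strictMono_nat_of_lt_succ fun i => by
    obtain ⟨n, hn⟩ := hw.nonempty i
    obtain ⟨h1, h2⟩ := Finset.mem_Ico.1 (hwk i hn)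
    omega
  by_cases hsmall : ∀ ε : ℝ, 0 < ε → {i | ∃ n : ℕ,
      ε * n < (((w i : Set ℕ) ∩ Set.Iio n).ncard : ℝ)}.Finite
  · refine univ_notMem_summableIdeal (hr := hr) hsum ((hw.mem_iff _).2 ?_)
    rw [mem_densityIdeal_iff]
    intro ε hε
    -- With ε / 8 per block, ε / 4 * k j + ε / 8 * k (j + 1) ≤ ε / 4 * k (j + 1) by doubling, so the
    -- bound ε / 4 reproduces itself.
    obtain ⟨B, hB⟩ := (hsmall (ε / 8) (by positivity)).bddAbove
    have hB' : ∀ i, B < i → ∀ n : ℕ, (((w i : Set ℕ) ∩ Set.Iio n).ncard : ℝ) ≤ ε / 8 * n := by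
      intro i hi n
      by_contra hc
      exact absurd (hB ⟨n, not_le.1 hc⟩) (not_le.2 hi)
    have hwcard : ∀ i, B < i → ((w i).card : ℝ) ≤ ε / 8 * k (i + 1) := by
      intro i hi
      have h1 := hB' i hi (k (i + 1))
      have h2 : (w i : Set ℕ) ∩ Set.Iio (k (i + 1)) = w i :=
        Set.inter_eq_left.2 fun n hn => (Finset.mem_Ico.1 (hwk i hn)).2
      rwa [h2, Set.ncard_coe_finset] at h1
    have hun : ∀ j, (((⋃ i ∈ (Set.univ : Set ℕ), (w i : Set ℕ)) ∩ Set.Iio (k (B + 1 + j))).ncard : ℝ)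
        ≤ k (B + 1) + ε / 4 * k (B + 1 + j) := by
      intro j
      induction j with
      | zero =>
        have h1 : ((⋃ i ∈ (Set.univ : Set ℕ), (w i : Set ℕ)) ∩ Set.Iio (k (B + 1 + 0))).ncard ≤
            k (B + 1) := by
          refine (Set.ncard_le_ncard Set.inter_subset_right (Set.finite_Iio _)).trans ?_
          rw [← Finset.coe_Iio, Set.ncard_coe_finset]
          simp
        have h2 : (0 : ℝ) ≤ ε / 4 * k (B + 1 + 0) := by positivity
        have h3 : ((((⋃ i ∈ (Set.univ : Set ℕ), (w i : Set ℕ)) ∩ Set.Iio (k (B + 1 + 0))).ncard : ℕ)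
          : ℝ) ≤ k (B + 1) := by exact_mod_cast h1
        linarith
      | succ j ih =>
        have h1 : (⋃ i ∈ (Set.univ : Set ℕ), (w i : Set ℕ)) ∩ Set.Iio (k (B + 1 + (j + 1))) ⊆
            ((⋃ i ∈ (Set.univ : Set ℕ), (w i : Set ℕ)) ∩ Set.Iio (k (B + 1 + j))) ∪
              (w (B + 1 + j) : Set ℕ) := by
          rintro n ⟨hn, hnk⟩
          by_cases hlt : n < k (B + 1 + j)
          · exact Or.inl ⟨hn, hlt⟩
          · right
            simp only [Set.mem_iUnion] at hn
            obtain ⟨i, -, hi⟩ := hn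
            obtain ⟨h2, h3⟩ := Finset.mem_Ico.1 (hwk i hi)
            have h4 : i < B + 1 + (j + 1) := hkm.lt_iff_lt.1 (h2.trans_lt hnk)
            have h5 : B + 1 + j < i + 1 := hkm.lt_iff_lt.1 ((not_lt.1 hlt).trans_lt h3)
            obtain rfl : i = B + 1 + j := by omega
            exact hi
        have h2 := (Set.ncard_le_ncard h1 (((Set.finite_Iio _).subset Set.inter_subset_right).union
          (w (B + 1 + j)).finite_toSet)).trans (Set.ncard_union_le _ _)
        rw [Set.ncard_coe_finset] at h2
        have h3 : ((((⋃ i ∈ (Set.univ : Set ℕ), (w i : Set ℕ)) ∩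
          Set.Iio (k (B + 1 + (j + 1)))).ncard : ℕ) : ℝ) ≤
          (((⋃ i ∈ (Set.univ : Set ℕ), (w i : Set ℕ)) ∩ Set.Iio (k (B + 1 + j))).ncard : ℝ) +
            (w (B + 1 + j)).card := by exact_mod_cast h2
        have h4 := hwcard (B + 1 + j) (by omega)
        have h5 : 2 * (k (B + 1 + j) : ℝ) ≤ k (B + 1 + j + 1) := by exact_mod_cast hk (B + 1 + j)
        rw [← add_assoc] at h3 ⊢
        nlinarith
    obtain ⟨M, hM⟩ := exists_nat_ge ((k (B + 1) : ℝ) / (ε / 4))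
    refine ⟨max M (k (B + 1)), fun n hn => ?_⟩
    obtain ⟨j, hj2, hj1⟩ := (hkm.comp (add_right_strictMono (a := B + 1))).exists_mem_Ico
      (n := n) ((le_max_right _ _).trans hn)
    simp only [Function.comp_apply] at hj1 hj2
    have h1 : (⋃ i ∈ (Set.univ : Set ℕ), (w i : Set ℕ)) ∩ Set.Iio n ⊆
        ((⋃ i ∈ (Set.univ : Set ℕ), (w i : Set ℕ)) ∩ Set.Iio (k (B + 1 + j))) ∪
          ((w (B + 1 + j) : Set ℕ) ∩ Set.Iio n) := by
      rintro l ⟨hl, hln⟩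
      by_cases hlt : l < k (B + 1 + j)
      · exact Or.inl ⟨hl, hlt⟩
      · refine Or.inr ⟨?_, hln⟩
        simp only [Set.mem_iUnion] at hl
        obtain ⟨i, -, hi⟩ := hl
        obtain ⟨h2, h3⟩ := Finset.mem_Ico.1 (hwk i hi)
        have h4 : i < B + 1 + (j + 1) := hkm.lt_iff_lt.1 (h2.trans_lt ((Set.mem_Iio.1 hln).trans hj1))
        have h5 : B + 1 + j < i + 1 := hkm.lt_iff_lt.1 ((not_lt.1 hlt).trans_lt h3)
        obtain rfl : i = B + 1 + j := by omega
        exact hi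
    have h2 := (Set.ncard_le_ncard h1 (((Set.finite_Iio _).subset Set.inter_subset_right).union
      ((Set.finite_Iio _).subset Set.inter_subset_right))).trans (Set.ncard_union_le _ _)
    have h3 : ((((⋃ i ∈ (Set.univ : Set ℕ), (w i : Set ℕ)) ∩ Set.Iio n).ncard : ℕ) : ℝ) ≤
        (((⋃ i ∈ (Set.univ : Set ℕ), (w i : Set ℕ)) ∩ Set.Iio (k (B + 1 + j))).ncard : ℝ) +
          (((w (B + 1 + j) : Set ℕ) ∩ Set.Iio n).ncard : ℝ) := by exact_mod_cast h2
    have h4 := hB' (B + 1 + j) (by omega) n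
    have h5 := hun j
    have h6 : (k (B + 1 + j) : ℝ) ≤ n := by exact_mod_cast hj2
    have h7 : (k (B + 1) : ℝ) ≤ ε / 4 * n := by
      have : (M : ℝ) ≤ n := by exact_mod_cast (le_max_left _ _).trans hn
      rw [mul_comm]
      exact (div_le_iff₀ (by positivity)).1 (hM.trans this)
    have h8 : ε / 4 * k (B + 1 + j) ≤ ε / 4 * n := mul_le_mul_of_nonneg_left h6 (by positivity)
    have h9 : 0 ≤ ε * n := by positivity
    linarith
  · simp only [not_forall] at hsmall
    obtain ⟨ε, hε, hinf⟩ := hsmall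
    obtain ⟨y, hyT, hy, hyI⟩ :=
      Set.Infinite.exists_infinite_subset_mem_summableIdeal hr hr0 hinf
    obtain ⟨N, hN⟩ := mem_densityIdeal_iff.1 ((hw.mem_iff y).1 hyI) ε hε
    obtain ⟨i, hi, hNi⟩ := hy.exists_gt N
    obtain ⟨n, hn⟩ := hyT hi
    by_cases hnN : N ≤ n
    · have h1 := hN n hnN
      have h2 : ((w i : Set ℕ) ∩ Set.Iio n).ncard ≤
          ((⋃ i ∈ y, (w i : Set ℕ)) ∩ Set.Iio n).ncard :=
        ncard_inter_Iio_mono fun l hl => Set.mem_biUnion hi hl.1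
      have h3 : ((((w i : Set ℕ) ∩ Set.Iio n).ncard : ℕ) : ℝ) ≤
          ((⋃ i ∈ y, (w i : Set ℕ)) ∩ Set.Iio n).ncard := by exact_mod_cast h2
      linarith
    -- Here n < N < i ≤ k i, so w i has no points below n and cannot have positive density there.
    · have h1 : (w i : Set ℕ) ∩ Set.Iio n = ∅ := by
        refine Set.eq_empty_of_forall_notMem ?_
        rintro l ⟨hl, hln⟩
        have h2 := (Finset.mem_Ico.1 (hwk i hl)).1
        have h3 : i ≤ k i := hkm.le_apply
        have h4 : l < n := hln
        omega
      rw [h1, Set.ncard_empty] at hn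
      have : 0 ≤ ε * n := by positivity
      simp only [Nat.cast_zero] at hn
      linarith

theorem theoremt (r : ℕ → ℝ) (hr : ∀ n, 0 ≤ r n) (hr0 : Tendsto r atTop (𝓝 0))
    (hsum : Tendsto (fun N => ∑ n ∈ Finset.range N, r n) atTop atTop) :
    (∀ J : Order.Ideal (Set ℕ), IsBorelIdeal J → IsPIdeal J →
      IdealBorelReducible (summableIdeal r hr) J → RBppExponentially (summableIdeal r hr) J) ∧
    ¬ IdealBorelReducible (summableIdeal r hr) densityIdeal := by
  refine ⟨fun J hJ hP hred => hP.rbppExponentially hr0 hsum hJ hred, fun hred => ?_⟩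
  exact not_rbppExponentially_densityIdeal hr0 hsum
    (isPIdeal_densityIdeal.rbppExponentially hr0 hsum isBorelIdeal_densityIdeal hred)
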